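/- Conventions. $\mathscr{S}(\mathbf R^n)$ is the Schwartz space; tempered distributions $T\in\mathscr{S}'(\mathbf R^n)$ are continuous antilinear functionals $\varphi\mapsto(T,\varphi)$; $\widehat f(\xi)=(2\pi)^{-n/2}\int f(x)e^{-i\langle x,\xi\rangle}\,dx$; $T_af(x)=f(x-a)$, $M_bf(x)=e^{i\langle x,b\rangle}f(x)$, extended to distributions by $(T_aT,\varphi)=(T,T_{-a}\varphi)$ and $(M_bT,\varphi)=(T,M_{-b}\varphi)$; $(T\circ B,\varphi)=|\det B|^{-1}(T,\varphi\circ B^{-1})$ for invertible linear $B$. A measure $\nu$ with $\int(1+|x|)^{-s}d\nu<\infty$ for some $s \geq 0$ (a tempered measure) is the distribution $(\nu,\varphi)=\int\overline{\varphi}\,d\nu$, and $\check\nu$ is its image under $x\mapsto -x$. Let $\kappa(x,y)=(x+\frac y2,x-\frac y2)$, let $\mathscr{F}_2$ be the partial Fourier transform in the second of two $\mathbf R^n$-variables, and let $W(g,f)=\mathscr{F}_2((g\otimes\overline f)\circ\kappa)$ for $f,g\in\mathscr{S}(\mathbf R^n)$. Let $(\Omega,\mathbf P)$ be a probability space. A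 tempered generalized stochastic process (GSP) on $\mathbf R^n$ is a continuous antilinear map $u:\mathscr{S}(\mathbf R^n)\to L^2(\Omega)$, $\varphi\mapsto(u,\varphi)$. Its mean is $(\mathbf E u,\varphi)=\mathbf E(u,\varphi)$, its covariance operator $\mathscr{K}_u:\mathscr{S}(\mathbf R^n)\to\mathscr{S}'(\mathbf R^n)$ is $(\mathscr{K}_u\psi,\varphi)=\mathbf E((u,\varphi)\overline{(u,\psi)})$, and $\widehat u$ is defined by $(\widehat u,\widehat\varphi)=(u,\varphi)$. The Weyl symbol of $\mathscr{K}:\mathscr{S}(\mathbf R^n)\to\mathscr{S}'(\mathbf R^n)$ is the $\sigma\in\mathscr{S}'(\mathbf R^{2n})$ with $(\mathscr{K}f,g)=(2\pi)^{-n/2}(\sigma,W(g,f))$ for all $f,g \in \mathscr{S}(\mathbf R^n)$. The GSP $u$ is Gaussian if the real and imaginary parts of $(u,\varphi_1),\dots,(u,\varphi_k)$ are always jointly (possibly degenerate) Gaussian; symmetric if $\lambda u$ and $u$ have the same finite-dimensional laws for all $|\lambda|=1$; stationary if $\mathbf E u$ is constant and $(\mathscr{K}_uT_x\psi,T_x\varphi)=(\mathscr{K}_u\psi,\varphi)$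 for all $x,\varphi,\psi$; frequency stationary if $\widehat u$ is stationary. A tempered non-negative measure $\mu_v$ is the spectral measure of $v$ if there is $h\in\mathscr{S}'(\mathbf R^n)$ with $(\mathscr{K}_v\psi,\varphi)=(h,\varphi*\psi^*)$ for all $\varphi,\psi\in\mathscr{S}(\mathbf R^n)$, where $\psi^*(x)=\overline{\psi(-x)}$, and $\mu_v=(2\pi)^{n/2}\widehat h$. Proposition. Let $u$ be a zero mean, symmetric, Gaussian and frequency stationary tempered GSP on $\mathbf R^d$ such that $\widehat u$ has the (non-negative, tempered) spectral measure $\mu_{\widehat u}$. Then there is exactly one tempered GSP $U=u\otimes\overline u$ on $\mathbf R^{2d}$ with $(U,\varphi\otimes\overline\psi)=(u,\varphi)\overline{(u,\psi)}$ for all $\varphi,\psi\in\mathscr{S}(\mathbf R^d)$. Put $U_0=U-\mathbf E U$ and define the Wigner distribution and the zero mean Wigner distribution of $u$ as the GSPs on $\mathbf R^{2d}$ given by $(W(u),\Phi)=(U,(\mathscr{F}_2^{-1}\Phi)\circ\kappa^{-1})$ and $(W_0(u),\Phi)=(U_0,(\mathscr{F}_2^{-1}\Phi)\circ\kappa^{-1})$.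 Then $$\mathbf E W(u)=(2\pi)^{-d/2}\,\check\mu_{\widehat u}\otimes 1,$$ the covariance operator $\mathscr{K}_{W_0(u)}$ has a unique Weyl symbol $\sigma_W\in\mathscr{S}'(\mathbf R^{4d})$, and $$\sigma_W(x_1,x_2,\xi_1,\xi_2)=\mu_{\widehat u}\left(-x_1+\tfrac12\xi_2\right)\mu_{\widehat u}\left(-x_1-\tfrac12\xi_2\right),$$ that is, $\sigma_W=(\mu_{\widehat u}\otimes\mu_{\widehat u}\otimes1\otimes1)\circ B$ with $B(x_1,x_2,\xi_1,\xi_2)=(-x_1+\frac12\xi_2,\,-x_1-\frac12\xi_2,\,x_2,\,\xi_1)$. Moreover, for all $x,\xi\in\mathbf R^d$, $$T_{0,x,\xi,0}\,\sigma_W=\sigma_W\qquad\text{and}\qquad \mathscr{K}_{W_0(u)}T_{(0,x)}M_{(\xi,0)}=T_{(0,x)}M_{(\xi,0)}\mathscr{K}_{W_0(u)}.$$ -/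

import Mathlib

open MeasureTheory SchwartzMap
open scoped FourierTransform ContDiff InnerProductSpace

noncomputable section
namespace WignerGSP

set_option linter.unusedSectionVars false
set_option linter.unnecessarySeqFocus false

section PartialFourier

variable {X Y G : Type} [NormedAddCommGroup X] [NormedSpace ℝ X]
  [NormedAddCommGroup Y] [InnerProductSpace ℝ Y] [FiniteDimensional ℝ Y]
  [MeasurableSpace Y] [BorelSpace Y] [NormedAddCommGroup G] [NormedSpace ℝ G] [NormedSpace ℂ G]
  [IsScalarTower ℝ ℂ G]

/-- The character `exp(-i⟨y, η⟩)`. -/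
def chi (y η : Y) : ℂ := Complex.exp ((-⟪y, η⟫_ℝ : ℝ) * Complex.I)

lemma norm_chi (y η : Y) : ‖chi y η‖ = 1 := Complex.norm_exp_ofReal_mul_I _

lemma chi_hasFDerivAt {Z : Type} [NormedAddCommGroup Z] [NormedSpace ℝ Z]
    {f : Z → ℝ} {f' : Z →L[ℝ] ℝ} {z : Z} (hf : HasFDerivAt f f' z) :
    HasFDerivAt (fun z => Complex.exp ((-f z : ℝ) * Complex.I))
      ((-Complex.I * Complex.exp ((-f z : ℝ) * Complex.I)) •
        (Complex.ofRealCLM.comp f')) z := by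
  have h1 := ((Complex.ofRealCLM.hasFDerivAt (x := -f z)).comp z hf.neg).mul_const Complex.I
  convert! h1.cexp using 1
  ext v; simp; ring

/-- The unnormalized partial Fourier transform in the second variable, as a function. -/
def pfFun (Φ : 𝓢(X × Y, G)) (p : X × Y) : G := ∫ y, chi y p.2 • Φ (p.1, y)

/-- The derivative of the partial Fourier transform is the partial Fourier transform of this. -/
def pfDeriv : 𝓢(X × Y, G) →L[ℝ] 𝓢(X × Y, X × Y →L[ℝ] G) :=
  (postcompCLM (((ContinuousLinearMap.compL ℝ (X × Y) (X × Y) G).flip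
      ((ContinuousLinearMap.inl ℝ X Y).comp (ContinuousLinearMap.fst ℝ X Y))))).comp
    (fderivCLM ℝ (X × Y) G)
  + (-Complex.I) • smulRightCLM ℝ G
      ((innerSL ℝ).bilinearComp (ContinuousLinearMap.snd ℝ X Y) (ContinuousLinearMap.snd ℝ X Y))

/-- The derivative in the second variable. -/
def pfDeriv₂ : 𝓢(X × Y, G) →L[ℝ] 𝓢(X × Y, Y →L[ℝ] G) :=
  (postcompCLM ((ContinuousLinearMap.compL ℝ Y (X × Y) G).flip
      (ContinuousLinearMap.inr ℝ X Y))).comp (fderivCLM ℝ (X × Y) G)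

lemma pfDeriv_apply (Φ : 𝓢(X × Y, G)) (p : X × Y) :
    pfDeriv Φ p = (fderiv ℝ Φ p).comp
        ((ContinuousLinearMap.inl ℝ X Y).comp (ContinuousLinearMap.fst ℝ X Y))
      + (-Complex.I) •
        ((innerSL ℝ p.2).comp (ContinuousLinearMap.snd ℝ X Y)).smulRight (Φ p) := by
  rfl

lemma pfDeriv₂_apply (Φ : 𝓢(X × Y, G)) (p : X × Y) :
    pfDeriv₂ Φ p = (fderiv ℝ Φ p).comp (ContinuousLinearMap.inr ℝ X Y) := rfl

/-- Uniform decay of the slices. -/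
lemma pf_decay (Φ : 𝓢(X × Y, G)) (k N : ℕ) (p : X × Y) :
    ‖p.1‖ ^ k * ‖Φ p‖ ≤ 2 ^ (k + N) * ((Finset.Iic (k + N, 0)).sup
      (schwartzSeminormFamily ℝ (X × Y) G) Φ) * (1 + ‖p.2‖) ^ (-(N : ℝ)) := by
  have h := one_add_le_sup_seminorm_apply (𝕜 := ℝ) (m := (k + N, 0)) le_rfl le_rfl Φ p
  rw [norm_iteratedFDeriv_zero] at h
  have h1 : ‖p.1‖ ≤ ‖p‖ := le_max_left _ _
  have h2 : ‖p.2‖ ≤ ‖p‖ := le_max_right _ _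
  rw [Real.rpow_neg (by positivity), ← div_eq_mul_inv, le_div_iff₀ (by positivity),
    Real.rpow_natCast]
  refine le_trans ?_ h
  rw [pow_add]
  have e1 : ‖p.1‖ ^ k ≤ (1 + ‖p‖) ^ k := by gcongr; linarith
  have e2 : (1 + ‖p.2‖) ^ N ≤ (1 + ‖p‖) ^ N := by gcongr
  calc ‖p.1‖ ^ k * ‖Φ p‖ * (1 + ‖p.2‖) ^ N
      = ‖p.1‖ ^ k * (1 + ‖p.2‖) ^ N * ‖Φ p‖ := by ring
    _ ≤ (1 + ‖p‖) ^ k * (1 + ‖p‖) ^ N * ‖Φ p‖ := by gcongr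

lemma pf_slice_integrable (Φ : 𝓢(X × Y, G)) (x : X) :
    Integrable (fun y => Φ (x, y)) (volume : Measure Y) := by
  obtain ⟨N, hN⟩ := (inferInstance : (volume : Measure Y).HasTemperateGrowth).exists_integrable
  refine (hN.const_mul (2 ^ (0 + N) * ((Finset.Iic (0 + N, 0)).sup
      (schwartzSeminormFamily ℝ (X × Y) G) Φ))).mono'
    (Φ.continuous.comp (by fun_prop)).aestronglyMeasurable (.of_forall fun y => ?_)
  simpa using pf_decay Φ 0 N (x, y)

lemma pf_continuous (Φ : 𝓢(X × Y, G)) (q : X × Y) :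
    Continuous (fun y => chi y q.2 • Φ (q.1, y)) :=
  Continuous.smul (by unfold chi; fun_prop) (Φ.continuous.comp (by fun_prop))

lemma pf_aestronglyMeasurable (Φ : 𝓢(X × Y, G)) (q : X × Y) :
    AEStronglyMeasurable (fun y => chi y q.2 • Φ (q.1, y)) :=
  (pf_continuous Φ q).aestronglyMeasurable

lemma pf_integrable (Φ : 𝓢(X × Y, G)) (q : X × Y) :
    Integrable (fun y => chi y q.2 • Φ (q.1, y)) :=
  (pf_slice_integrable Φ q.1).mono (pf_continuous Φ q).aestronglyMeasurable
    (.of_forall fun y => by simp [norm_smul, norm_chi])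

lemma pf_hasFDerivAt (Φ : 𝓢(X × Y, G)) (p : X × Y) :
    HasFDerivAt (pfFun Φ) (pfFun (pfDeriv Φ) p) p := by
  obtain ⟨N, hN⟩ := (inferInstance : (volume : Measure Y).HasTemperateGrowth).exists_integrable
  refine hasFDerivAt_integral_of_dominated_of_fderiv_le (μ := (volume : Measure Y))
    (𝕜 := ℝ) (x₀ := p) (s := Set.univ)
    (F := fun (q : X × Y) y => chi y q.2 • Φ (q.1, y))
    (F' := fun (q : X × Y) y => chi y q.2 • pfDeriv Φ (q.1, y))
    (bound := fun y => 2 ^ (0 + N) * ((Finset.Iic (0 + N, 0)).sup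
      (schwartzSeminormFamily ℝ (X × Y) (X × Y →L[ℝ] G)) (pfDeriv Φ))
        * (1 + ‖y‖) ^ (-(N : ℝ))) Filter.univ_mem
    (.of_forall fun q => (pf_continuous Φ q).aestronglyMeasurable) (pf_integrable Φ p)
    (pf_aestronglyMeasurable (pfDeriv Φ) p) ?_ (hN.const_mul _) ?_
  · refine .of_forall fun y q _ => ?_
    simpa [norm_smul, norm_chi] using pf_decay (pfDeriv Φ) 0 N (q.1, y)
  · refine .of_forall fun y q _ => ?_
    have h1 : HasFDerivAt (fun q : X × Y => Φ (q.1, y))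
        ((fderiv ℝ Φ (q.1, y)).comp
          ((ContinuousLinearMap.inl ℝ X Y).comp (ContinuousLinearMap.fst ℝ X Y))) q := by
      refine (Φ.differentiableAt (x := (q.1, y))).hasFDerivAt.comp q ?_
      convert! (((ContinuousLinearMap.inl ℝ X Y).comp
        (ContinuousLinearMap.fst ℝ X Y)).hasFDerivAt (x := q)).add_const ((0 : X), y) using 1
      ext z <;> simp
    have h3 := chi_hasFDerivAt
      (((innerSL ℝ y).comp (ContinuousLinearMap.snd ℝ X Y)).hasFDerivAt (x := q))
    convert! h3.smul h1 using 1
    ext z <;>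
    · simp [pfDeriv_apply, chi, smul_smul, mul_comm]
      try module

lemma pf_byParts (Φ : 𝓢(X × Y, G)) (p : X × Y) (v : Y) :
    (Complex.I * (⟪v, p.2⟫_ℝ : ℝ)) • pfFun Φ p = pfFun (pfDeriv₂ Φ) p v := by
  have hd : ∀ y, HasFDerivAt (fun y => Φ (p.1, y)) (pfDeriv₂ Φ (p.1, y)) y := fun y => by
    rw [pfDeriv₂_apply]
    refine (Φ.differentiableAt (x := (p.1, y))).hasFDerivAt.comp y ?_
    convert! ((ContinuousLinearMap.inr ℝ X Y).hasFDerivAt (x := y)).add_const (p.1, (0 : Y)) using 1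
    ext z <;> simp
  have hc : ∀ y, HasFDerivAt (fun y => chi y p.2)
      ((-Complex.I * chi y p.2) • (Complex.ofRealCLM.comp (innerSL ℝ p.2))) y := fun y => by
    have := chi_hasFDerivAt ((innerSL ℝ p.2).hasFDerivAt (x := y))
    simpa [chi, real_inner_comm] using this
  have e1 : pfFun (pfDeriv₂ Φ) p v = ∫ y, chi y p.2 • fderiv ℝ (fun y => Φ (p.1, y)) y v := by
    rw [pfFun, ContinuousLinearMap.integral_apply (pf_integrable _ p)]
    simp [(hd _).fderiv]
  have e2 : ∀ y, fderiv ℝ (fun y => chi y p.2) y v • Φ (p.1, y)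
      = (-(Complex.I * (⟪v, p.2⟫_ℝ : ℝ))) • (chi y p.2 • Φ (p.1, y)) := fun y => by
    rw [(hc y).fderiv, smul_smul]
    simp [real_inner_comm]; ring_nf
  rw [e1, integral_smul_fderiv_eq_neg_fderiv_smul_of_integrable]
  · simp_rw [e2]
    rw [integral_smul, neg_smul, neg_neg, pfFun]
  · simp_rw [e2]
    exact (pf_integrable Φ p).smul _
  · simpa [(hd _).fderiv] using (pf_integrable (pfDeriv₂ Φ) p).apply_continuousLinearMap v
  · exact pf_integrable Φ p
  · exact fun y _ => (hc y).differentiableAt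
  · exact fun y _ => (hd y).differentiableAt

lemma pf_norm_mul (Φ : 𝓢(X × Y, G)) (p : X × Y) :
    ‖p.2‖ * ‖pfFun Φ p‖ ≤ ‖pfFun (pfDeriv₂ Φ) p‖ := by
  rcases eq_or_ne p.2 0 with h | h
  · simp [h]
  have h1 := congrArg norm (pf_byParts Φ p p.2)
  rw [norm_smul, norm_mul, Complex.norm_I, one_mul, Complex.norm_real,
    real_inner_self_eq_norm_sq, norm_pow, norm_norm] at h1
  have h2 := (pfFun (pfDeriv₂ Φ) p).le_opNorm p.2
  rw [← h1] at h2
  have h3 : 0 < ‖p.2‖ := norm_pos_iff.2 h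
  nlinarith

end PartialFourier

section Bounds

variable {X Y : Type} [NormedAddCommGroup X] [NormedSpace ℝ X]
  [NormedAddCommGroup Y] [InnerProductSpace ℝ Y] [FiniteDimensional ℝ Y]
  [MeasurableSpace Y] [BorelSpace Y]

lemma pf_bound_mixed (k j : ℕ) : ∀ (G : Type) [NormedAddCommGroup G] [NormedSpace ℝ G]
    [NormedSpace ℂ G] [IsScalarTower ℝ ℂ G],
    ∃ q : Seminorm ℝ 𝓢(X × Y, G), Continuous q ∧
      ∀ Φ p, ‖p.1‖ ^ k * ‖p.2‖ ^ j * ‖pfFun Φ p‖ ≤ q Φ := by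
  induction j with
  | zero =>
    intro G _ _ _ _
    obtain ⟨N, hN⟩ := (inferInstance : (volume : Measure Y).HasTemperateGrowth).exists_integrable
    set C : ℝ := 2 ^ (k + N) * ∫ y : Y, (1 + ‖y‖) ^ (-(N : ℝ)) with hC
    have hC0 : 0 ≤ C := by positivity
    refine ⟨C.toNNReal •
      ((Finset.Iic (k + N, 0)).sup (schwartzSeminormFamily ℝ (X × Y) G) :
        Seminorm ℝ 𝓢(X × Y, G)), ?_, fun Φ p => ?_⟩
    · have h1 : Continuous ((Finset.Iic (k + N, 0)).sup (schwartzSeminormFamily ℝ (X × Y) G) :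
          Seminorm ℝ 𝓢(X × Y, G)) := by
        refine Seminorm.continuous_finsetSup (fun i _ => ?_)
        exact (schwartz_withSeminorms ℝ (X × Y) G).continuous_seminorm i
      exact continuous_const.mul h1
    · have h1 : ‖p.1‖ ^ k * ‖pfFun Φ p‖ ≤ ∫ y, ‖p.1‖ ^ k * ‖Φ (p.1, y)‖ := by
        rw [integral_const_mul]
        gcongr
        refine (norm_integral_le_integral_norm _).trans (le_of_eq ?_)
        simp [norm_smul, norm_chi]
      rw [pow_zero, mul_one]
      refine h1.trans ?_
      have h2 : ∫ y, ‖p.1‖ ^ k * ‖Φ (p.1, y)‖ ≤ ∫ y : Y, 2 ^ (k + N) *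
          ((Finset.Iic (k + N, 0)).sup (schwartzSeminormFamily ℝ (X × Y) G) Φ)
          * (1 + ‖y‖) ^ (-(N : ℝ)) :=
        integral_mono ((pf_slice_integrable Φ p.1).norm.const_mul _) (hN.const_mul _)
          fun y => pf_decay Φ k N (p.1, y)
      refine h2.trans (le_of_eq ?_)
      rw [integral_const_mul]
      change _ = (C.toNNReal : ℝ) * _
      rw [Real.coe_toNNReal _ hC0, hC]; ring
  | succ j ih =>
    intro G _ _ _ _
    obtain ⟨q, hq, h⟩ := ih (Y →L[ℝ] G)
    refine ⟨q.comp (pfDeriv₂ (X := X) (Y := Y) (G := G)).toLinearMap,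
      hq.comp pfDeriv₂.continuous, fun Φ p => ?_⟩
    refine le_trans ?_ (h (pfDeriv₂ Φ) p)
    rw [pow_succ]
    have := pf_norm_mul Φ p
    calc ‖p.1‖ ^ k * (‖p.2‖ ^ j * ‖p.2‖) * ‖pfFun Φ p‖
        = ‖p.1‖ ^ k * ‖p.2‖ ^ j * (‖p.2‖ * ‖pfFun Φ p‖) := by ring
      _ ≤ _ := by gcongr

lemma pf_contDiff (n : ℕ) : ∀ (G : Type) [NormedAddCommGroup G] [NormedSpace ℝ G]
    [NormedSpace ℂ G] [IsScalarTower ℝ ℂ G] (Φ : 𝓢(X × Y, G)), ContDiff ℝ n (pfFun Φ) := by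
  induction n with
  | zero =>
    intro G _ _ _ _ Φ
    exact contDiff_zero.2 (continuous_iff_continuousAt.2 fun p => (pf_hasFDerivAt Φ p).continuousAt)
  | succ n ih =>
    intro G _ _ _ _ Φ
    rw [Nat.cast_succ, contDiff_succ_iff_fderiv]
    refine ⟨fun p => (pf_hasFDerivAt Φ p).differentiableAt, fun h => by simp at h, ?_⟩
    rw [show fderiv ℝ (pfFun Φ) = pfFun (pfDeriv Φ) from
      funext fun p => (pf_hasFDerivAt Φ p).fderiv]
    exact ih _ _

lemma pf_bound (k n : ℕ) : ∀ (G : Type) [NormedAddCommGroup G] [NormedSpace ℝ G]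
    [NormedSpace ℂ G] [IsScalarTower ℝ ℂ G],
    ∃ q : Seminorm ℝ 𝓢(X × Y, G), Continuous q ∧
      ∀ Φ p, ‖p‖ ^ k * ‖iteratedFDeriv ℝ n (pfFun Φ) p‖ ≤ q Φ := by
  induction n with
  | zero =>
    intro G _ _ _ _
    obtain ⟨q₁, hq₁, h₁⟩ := pf_bound_mixed (X := X) (Y := Y) k 0 G
    obtain ⟨q₂, hq₂, h₂⟩ := pf_bound_mixed (X := X) (Y := Y) 0 k G
    refine ⟨q₁ + q₂, hq₁.add hq₂, fun Φ p => ?_⟩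
    rw [norm_iteratedFDeriv_zero]
    have a := h₁ Φ p
    have b := h₂ Φ p
    rw [pow_zero, mul_one] at a
    rw [pow_zero, one_mul] at b
    change _ ≤ q₁ Φ + q₂ Φ
    rcases max_cases ‖p.1‖ ‖p.2‖ with h | h
    · rw [Prod.norm_def, h.1]
      linarith [apply_nonneg q₂ Φ]
    · rw [Prod.norm_def, h.1]
      linarith [apply_nonneg q₁ Φ]
  | succ n ih =>
    intro G _ _ _ _
    obtain ⟨q, hq, h⟩ := ih (X × Y →L[ℝ] G)
    refine ⟨q.comp (pfDeriv (X := X) (Y := Y) (G := G)).toLinearMap,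
      ?_, fun Φ p => ?_⟩
    · exact hq.comp (pfDeriv (X := X) (Y := Y) (G := G)).continuous
    rw [← norm_iteratedFDeriv_fderiv, show fderiv ℝ (pfFun Φ) = pfFun (pfDeriv Φ) from
      funext fun p => (pf_hasFDerivAt Φ p).fderiv]
    exact h (pfDeriv Φ) p

lemma sup_seminorm_eq (s : Finset (ℕ × ℕ)) (Φ : 𝓢(X × Y, ℂ)) :
    s.sup (schwartzSeminormFamily ℝ (X × Y) ℂ) Φ = s.sup (schwartzSeminormFamily ℂ (X × Y) ℂ) Φ := by
  rw [Seminorm.finset_sup_apply, Seminorm.finset_sup_apply]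
  rfl

/-- The unnormalized partial Fourier transform `Φ ↦ ((x, η) ↦ ∫ exp(-i⟨y,η⟩) Φ(x,y) dy)`
on Schwartz functions. -/
def pfCLM : 𝓢(X × Y, ℂ) →L[ℂ] 𝓢(X × Y, ℂ) :=
  SchwartzMap.mkCLM (fun Φ => pfFun Φ)
    (fun Φ Ψ p => by
      simp only [pfFun, add_apply, smul_add]
      exact integral_add (pf_integrable Φ p) (pf_integrable Ψ p))
    (fun a Φ p => by
      simp only [pfFun, smul_apply, RingHom.id_apply]
      rw [← integral_smul]
      simp_rw [smul_comm a])
    (fun Φ => contDiff_infty.2 fun n => pf_contDiff n ℂ Φ)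
    (fun n => by
      obtain ⟨q, hq, h⟩ := pf_bound (X := X) (Y := Y) n.1 n.2 ℂ
      obtain ⟨s, C, -, hC⟩ := Seminorm.bound_of_continuous (schwartz_withSeminorms ℝ (X × Y) ℂ) q hq
      refine ⟨s, C, C.2, fun Φ p => (h Φ p).trans ?_⟩
      have := hC Φ
      rw [← sup_seminorm_eq]
      exact this)

lemma pfCLM_apply (Φ : 𝓢(X × Y, ℂ)) (p : X × Y) :
    pfCLM Φ p = ∫ y, chi y p.2 • Φ (p.1, y) := rfl

end Bounds

section Schwartz

variable {V : Type} [NormedAddCommGroup V] [InnerProductSpace ℝ V]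

/-- The space `V × V` with its Euclidean structure. For `V = ℝᵈ` this is `T*ℝᵈ = ℝ²ᵈ`. -/
abbrev Phase (V : Type) : Type := WithLp 2 (V × V)

/-- The point `(x, y)` of `V × V`. -/
abbrev pt (x y : V) : Phase V := WithLp.toLp 2 (x, y)

lemma phase_ext {p q : Phase V} (h₁ : p.fst = q.fst) (h₂ : p.snd = q.snd) : p = q :=
  WithLp.ofLp_injective 2 (Prod.ext h₁ h₂)

/-- Complex conjugation of a Schwartz function. -/
def conjS (f : 𝓢(V, ℂ)) : 𝓢(V, ℂ) :=
  postcompCLM (𝕜 := ℝ) (Complex.conjCLE : ℂ →L[ℝ] ℂ) f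

lemma conjS_apply (f : 𝓢(V, ℂ)) (x : V) : conjS f x = starRingEnd ℂ (f x) := rfl

/-- Composition `f ↦ f ∘ A` of Schwartz functions with a linear isomorphism. -/
abbrev compS {X X' : Type} [NormedAddCommGroup X] [NormedSpace ℝ X] [NormedAddCommGroup X']
    [NormedSpace ℝ X'] (A : X ≃L[ℝ] X') : 𝓢(X', ℂ) →L[ℂ] 𝓢(X, ℂ) :=
  compCLMOfContinuousLinearEquiv ℂ A

/-- Translation `T_a f(x) = f(x - a)`. -/
abbrev translS (a : V) : 𝓢(V, ℂ) →L[ℂ] 𝓢(V, ℂ) := compSubConstCLM ℂ a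

lemma hasTemperateGrowth_cexp_mul_I :
    (fun t : ℝ => Complex.exp (t * Complex.I)).HasTemperateGrowth := by
  refine ⟨(Complex.ofRealCLM.contDiff.mul contDiff_const).cexp, fun n => ⟨0, 1, fun t => ?_⟩⟩
  rw [norm_iteratedFDeriv_eq_norm_iteratedDeriv]
  have h : ∀ n : ℕ, iteratedDeriv n (fun t : ℝ => Complex.exp (t * Complex.I))
      = fun t : ℝ => Complex.I ^ n * Complex.exp (t * Complex.I) := by
    intro n
    induction n with
    | zero => simp
    | succ n ih =>
      rw [iteratedDeriv_succ, ih]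
      funext t
      have h1 : HasDerivAt (fun t : ℝ => (t : ℂ) * Complex.I) Complex.I t := by
        simpa using (Complex.ofRealCLM.hasDerivAt (x := t)).mul_const Complex.I
      rw [(h1.cexp.const_mul _).deriv]
      ring
  rw [h]
  simp [Complex.norm_exp_ofReal_mul_I]

lemma hasTemperateGrowth_modulation (b : V) :
    (fun x : V => Complex.exp ((⟪x, b⟫_ℝ : ℝ) * Complex.I)).HasTemperateGrowth :=
  hasTemperateGrowth_cexp_mul_I.comp (Function.hasTemperateGrowth_inner_left b)

/-- Modulation `M_b f(x) = exp(i⟨x, b⟩) f(x)`. -/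
def modS (b : V) : 𝓢(V, ℂ) →L[ℂ] 𝓢(V, ℂ) :=
  smulLeftCLM ℂ (fun x : V => Complex.exp ((⟪x, b⟫_ℝ : ℝ) * Complex.I))

lemma modS_apply (b : V) (f : 𝓢(V, ℂ)) (x : V) :
    modS b f x = Complex.exp ((⟪x, b⟫_ℝ : ℝ) * Complex.I) * f x := by
  rw [modS, smulLeftCLM_apply_apply (hasTemperateGrowth_modulation b), smul_eq_mul]

lemma norm_iteratedFDeriv_comp_contraction {X X' : Type} [NormedAddCommGroup X] [NormedSpace ℝ X]
    [NormedAddCommGroup X'] [NormedSpace ℝ X'] (f : 𝓢(X, ℂ)) (A : X' →L[ℝ] X) (hA : ‖A‖ ≤ 1)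
    (i : ℕ) (p : X') :
    ‖iteratedFDeriv ℝ i (fun p => f (A p)) p‖ ≤ ‖iteratedFDeriv ℝ i f (A p)‖ := by
  have h := A.iteratedFDeriv_comp_right (f.smooth ⊤) p (i := i) (mod_cast le_top)
  change iteratedFDeriv ℝ i (fun p => f (A p)) p = _ at h
  rw [h]
  refine (ContinuousMultilinearMap.norm_compContinuousLinearMap_le _ _).trans ?_
  refine mul_le_of_le_one_right (norm_nonneg _) (Finset.prod_le_one (fun _ _ => norm_nonneg _) ?_)
  exact fun _ _ => hA

/-- The tensor product `(x, y) ↦ f(x) g(y)` of Schwartz functions. -/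
def tensorProd (f g : 𝓢(V, ℂ)) : 𝓢(V × V, ℂ) where
  toFun p := f p.1 * g p.2
  smooth' := ((f.smooth ⊤).comp contDiff_fst).mul ((g.smooth ⊤).comp contDiff_snd)
  decay' k n := by
    refine ⟨∑ i ∈ Finset.range (n + 1), (n.choose i : ℝ) *
      (SchwartzMap.seminorm ℝ k i f * SchwartzMap.seminorm ℝ 0 (n - i) g
        + SchwartzMap.seminorm ℝ 0 i f * SchwartzMap.seminorm ℝ k (n - i) g), fun p => ?_⟩
    have h := norm_iteratedFDeriv_mul_le (𝕜 := ℝ) (N := ∞)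
      (f := fun p : V × V => f p.1) (g := fun p : V × V => g p.2)
      ((f.smooth ⊤).comp contDiff_fst) ((g.smooth ⊤).comp contDiff_snd) p (n := n)
      (mod_cast le_top)
    refine (mul_le_mul_of_nonneg_left h (by positivity)).trans ?_
    rw [Finset.mul_sum]
    refine Finset.sum_le_sum fun i _ => ?_
    have a := norm_iteratedFDeriv_comp_contraction f (ContinuousLinearMap.fst ℝ V V)
      (ContinuousLinearMap.norm_fst_le ..) i p
    have b := norm_iteratedFDeriv_comp_contraction g (ContinuousLinearMap.snd ℝ V V)
      (ContinuousLinearMap.norm_snd_le ..) (n - i) p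
    have a0 := SchwartzMap.le_seminorm ℝ 0 i f p.1
    have ak := SchwartzMap.le_seminorm ℝ k i f p.1
    have b0 := SchwartzMap.le_seminorm ℝ 0 (n - i) g p.2
    have bk := SchwartzMap.le_seminorm ℝ k (n - i) g p.2
    rw [pow_zero, one_mul] at a0 b0
    simp only [ContinuousLinearMap.coe_fst', ContinuousLinearMap.coe_snd'] at a b
    have hp : ‖p‖ ^ k ≤ ‖p.1‖ ^ k + ‖p.2‖ ^ k := by
      rcases max_cases ‖p.1‖ ‖p.2‖ with h | h <;> rw [Prod.norm_def, h.1]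
      · linarith [pow_nonneg (norm_nonneg p.2) k]
      · linarith [pow_nonneg (norm_nonneg p.1) k]
    set A := ‖iteratedFDeriv ℝ i (fun p : V × V => f p.1) p‖
    set B := ‖iteratedFDeriv ℝ (n - i) (fun p : V × V => g p.2) p‖
    set A' := ‖iteratedFDeriv ℝ i f p.1‖
    set B' := ‖iteratedFDeriv ℝ (n - i) g p.2‖
    have hA : 0 ≤ A := norm_nonneg _
    have hB : 0 ≤ B := norm_nonneg _
    have hA' : 0 ≤ A' := norm_nonneg _
    have hB' : 0 ≤ B' := norm_nonneg _
    calc ‖p‖ ^ k * (n.choose i * A * B)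
        ≤ (‖p.1‖ ^ k + ‖p.2‖ ^ k) * (n.choose i * A' * B') := by gcongr
      _ = n.choose i * ((‖p.1‖ ^ k * A') * B' + A' * (‖p.2‖ ^ k * B')) := by ring
      _ ≤ _ := by gcongr

/-- The tensor product `f ⊗ ḡ`, that is `(x, y) ↦ f(x) * conj (g(y))`. -/
def tensorConj (f g : 𝓢(V, ℂ)) : 𝓢(Phase V, ℂ) :=
  compS (WithLp.prodContinuousLinearEquiv 2 ℝ V V) (tensorProd f (conjS g))

lemma tensorConj_apply (f g : 𝓢(V, ℂ)) (x y : V) :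
    tensorConj f g (pt x y) = f x * starRingEnd ℂ (g y) := rfl

end Schwartz

section Transforms

variable {V : Type} [NormedAddCommGroup V] [InnerProductSpace ℝ V] [FiniteDimensional ℝ V]

/-- The matrix `κ`, that is `κ(x, y) = (x + y/2, x - y/2)`. -/
def kappa (V : Type) [NormedAddCommGroup V] [InnerProductSpace ℝ V] [FiniteDimensional ℝ V] :
    Phase V ≃L[ℝ] Phase V :=
  LinearEquiv.toContinuousLinearEquiv
    { toFun := fun p => pt (p.fst + (1 / 2 : ℝ) • p.snd) (p.fst - (1 / 2 : ℝ) • p.snd)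
      invFun := fun p => pt ((1 / 2 : ℝ) • p.fst + (1 / 2 : ℝ) • p.snd) (p.fst - p.snd)
      map_add' := fun p q => by apply phase_ext <;> simp <;> module
      map_smul' := fun c p => by apply phase_ext <;> simp <;> module
      left_inv := fun p => by apply phase_ext <;> simp <;> module
      right_inv := fun p => by apply phase_ext <;> simp <;> module }

/-- The reflection `(x, y) ↦ (x, -y)`. -/
def flipSnd (V : Type) [NormedAddCommGroup V] [InnerProductSpace ℝ V] [FiniteDimensional ℝ V] :
    Phase V ≃L[ℝ] Phase V :=
  LinearEquiv.toContinuousLinearEquiv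
    { toFun := fun p => pt p.fst (-p.snd)
      invFun := fun p => pt p.fst (-p.snd)
      map_add' := fun p q => by apply phase_ext <;> simp <;> module
      map_smul' := fun c p => by apply phase_ext <;> simp
      left_inv := fun p => by apply phase_ext <;> simp
      right_inv := fun p => by apply phase_ext <;> simp }

/-- The linear isomorphism
`(x₁, x₂, ξ₁, ξ₂) ↦ (-x₁ + ξ₂/2, -x₁ - ξ₂/2, x₂, ξ₁)`. -/
def symbolCoord (V : Type) [NormedAddCommGroup V] [InnerProductSpace ℝ V]
    [FiniteDimensional ℝ V] : Phase (Phase V) ≃L[ℝ] Phase (Phase V) :=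
  LinearEquiv.toContinuousLinearEquiv
    { toFun := fun z => pt
        (pt (-z.fst.fst + (1 / 2 : ℝ) • z.snd.snd) (-z.fst.fst - (1 / 2 : ℝ) • z.snd.snd))
        (pt z.fst.snd z.snd.fst)
      invFun := fun w => pt
        (pt (-((1 / 2 : ℝ) • (w.fst.fst + w.fst.snd))) w.snd.fst)
        (pt w.snd.snd (w.fst.fst - w.fst.snd))
      map_add' := fun p q => by
        apply phase_ext <;> apply phase_ext <;> simp <;> module
      map_smul' := fun c p => by
        apply phase_ext <;> apply phase_ext <;> simp <;> module
      left_inv := fun p => by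
        apply phase_ext <;> apply phase_ext <;> simp <;> module
      right_inv := fun p => by
        apply phase_ext <;> apply phase_ext <;> simp <;> module }

lemma kappa_apply (x y : V) :
    kappa V (pt x y) = pt (x + (1 / 2 : ℝ) • y) (x - (1 / 2 : ℝ) • y) := rfl

lemma kappa_symm_apply (x y : V) :
    (kappa V).symm (pt x y) = pt ((1 / 2 : ℝ) • x + (1 / 2 : ℝ) • y) (x - y) := rfl

lemma symbolCoord_apply (x₁ x₂ ξ₁ ξ₂ : V) :
    symbolCoord V (pt (pt x₁ x₂) (pt ξ₁ ξ₂))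
      = pt (pt (-x₁ + (1 / 2 : ℝ) • ξ₂) (-x₁ - (1 / 2 : ℝ) • ξ₂)) (pt x₂ ξ₁) := rfl

/-- The constant `(2π)^(-n/2)`, `n = dim V`. -/
def fourierConst (V : Type) [NormedAddCommGroup V] [InnerProductSpace ℝ V] : ℂ :=
  (((2 * Real.pi) ^ (-(Module.finrank ℝ V : ℝ) / 2) : ℝ) : ℂ)

lemma fourierConst_ne_zero : fourierConst V ≠ 0 :=
  Complex.ofReal_ne_zero.2 (Real.rpow_pos_of_pos (by positivity) _).ne'

variable [MeasurableSpace V] [BorelSpace V]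

/-- The partial Fourier transform `𝓕₂` on `𝓢(V × V)` in the second variable. -/
def partialFourier : 𝓢(Phase V, ℂ) →L[ℂ] 𝓢(Phase V, ℂ) :=
  fourierConst V • ((compS (WithLp.prodContinuousLinearEquiv 2 ℝ V V)).comp
    (pfCLM.comp (compS (WithLp.prodContinuousLinearEquiv 2 ℝ V V).symm)))

lemma partialFourier_apply (Φ : 𝓢(Phase V, ℂ)) (x η : V) :
    partialFourier Φ (pt x η)
      = fourierConst V * ∫ y, Complex.exp (-Complex.I * (⟪y, η⟫_ℝ : ℝ)) * Φ (pt x y) := by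
  change fourierConst V * ∫ y, Complex.exp ((-⟪y, η⟫_ℝ : ℝ) * Complex.I) * Φ (pt x y) = _
  congr 2
  ext y
  congr 2
  push_cast
  ring

/-- The inverse partial Fourier transform `𝓕₂⁻¹` on `𝓢(V × V)` in the second variable. -/
def partialFourierInv : 𝓢(Phase V, ℂ) →L[ℂ] 𝓢(Phase V, ℂ) :=
  (compS (flipSnd V)).comp partialFourier

lemma partialFourierInv_apply (Φ : 𝓢(Phase V, ℂ)) (x y : V) :
    partialFourierInv Φ (pt x y)
      = fourierConst V * ∫ η, Complex.exp (Complex.I * (⟪η, y⟫_ℝ : ℝ)) * Φ (pt x η) := by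
  change partialFourier Φ (pt x (-y)) = _
  rw [partialFourier_apply]
  simp [inner_neg_right]

/-- The Fourier transform on `𝓢(V)` in the normalization
`f̂(ξ) = (2π)^(-n/2) ∫ f(x) exp(-i⟨x, ξ⟩) dx`; see `fourierS_apply`. -/
def fourierS : 𝓢(V, ℂ) ≃L[ℂ] 𝓢(V, ℂ) :=
  (FourierTransform.fourierCLE ℂ 𝓢(V, ℂ)).trans
    ((ContinuousLinearEquiv.equivOfInverse
      (compS (ContinuousLinearEquiv.smulLeft
        (Units.mk0 ((2 * Real.pi)⁻¹ : ℝ) (by positivity)) : V ≃L[ℝ] V))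
      (compS (ContinuousLinearEquiv.smulLeft
        (Units.mk0 ((2 * Real.pi)⁻¹ : ℝ) (by positivity)) : V ≃L[ℝ] V).symm)
      (fun f => by ext x; simp) (fun f => by ext x; simp)).trans
    (ContinuousLinearEquiv.smulLeft (Units.mk0 (fourierConst V) fourierConst_ne_zero)))

lemma fourierS_apply (f : 𝓢(V, ℂ)) (ξ : V) :
    fourierS f ξ = fourierConst V * ∫ x, f x * Complex.exp (-Complex.I * (⟪x, ξ⟫_ℝ : ℝ)) := by
  change fourierConst V * (FourierTransform.fourier (f : V → ℂ)) ((2 * Real.pi)⁻¹ • ξ) = _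
  rw [Real.fourier_eq]
  congr 2
  ext x
  rw [Circle.smul_def, Real.fourierChar_apply, smul_eq_mul, mul_comm, real_inner_smul_right]
  congr 2
  push_cast
  have : (Real.pi : ℂ) ≠ 0 := Complex.ofReal_ne_zero.2 Real.pi_ne_zero
  field_simp

/-- The cross-Wigner distribution `W(g, f) = 𝓕₂((g ⊗ f̄) ∘ κ)`; see `crossWigner_apply`. -/
def crossWigner (g f : 𝓢(V, ℂ)) : 𝓢(Phase V, ℂ) :=
  partialFourier (compS (kappa V) (tensorConj g f))

lemma crossWigner_apply (g f : 𝓢(V, ℂ)) (x ξ : V) :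
    crossWigner g f (pt x ξ) = fourierConst V * ∫ y, Complex.exp (-Complex.I * (⟪y, ξ⟫_ℝ : ℝ)) *
      (g (x + (1 / 2 : ℝ) • y) * starRingEnd ℂ (f (x - (1 / 2 : ℝ) • y))) :=
  partialFourier_apply _ x ξ

end Transforms

section Distributions

variable {V : Type} [NormedAddCommGroup V] [InnerProductSpace ℝ V]

/-- Tempered distributions, as continuous antilinear functionals `φ ↦ (T, φ)` on `𝓢(V)`. -/
abbrev TempDist (V : Type) [NormedAddCommGroup V] [InnerProductSpace ℝ V] : Type :=
  𝓢(V, ℂ) →L⋆[ℂ] ℂ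

/-- Translation of a distribution, `(T_a T, φ) = (T, T_{-a} φ)`. -/
def translD (a : V) (T : TempDist V) : TempDist V := T.comp (translS (-a))

/-- Modulation of a distribution, `(M_b T, φ) = (T, M_{-b} φ)`. -/
def modD (b : V) (T : TempDist V) : TempDist V := T.comp (modS (-b))

/-- The composition `T ∘ B` of a distribution with a linear isomorphism,
`(T ∘ B, φ) = |det B|⁻¹ (T, φ ∘ B⁻¹)`. -/
def compD (T : TempDist V) (B : V ≃L[ℝ] V) : TempDist V :=
  ((|LinearMap.det (B : V →ₗ[ℝ] V)|⁻¹ : ℝ) : ℂ) • T.comp (compS B.symm)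

variable [MeasurableSpace V]

/-- The tempered distribution defined by a measure of temperate growth,
`(ν, φ) = ∫ conj φ dν`; see `measureD_apply`. -/
def measureD [BorelSpace V] [SecondCountableTopology V] (ν : Measure V) [ν.HasTemperateGrowth] :
    TempDist V :=
  ((starL ℂ : ℂ ≃L⋆[ℂ] ℂ) : ℂ →L⋆[ℂ] ℂ).comp (integralCLM ℂ ν)

lemma measureD_apply [BorelSpace V] [SecondCountableTopology V] (ν : Measure V)
    [ν.HasTemperateGrowth] (φ : 𝓢(V, ℂ)) :
    measureD ν φ = ∫ x, starRingEnd ℂ (φ x) ∂ν :=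
  integral_conj.symm

/-- The reflected measure `ν̌`, the image of `ν` under `x ↦ -x`. -/
def reflectM (ν : Measure V) : Measure V := ν.map (fun x => -x)

/-- The tensor product `ν ⊗ ρ`, a measure on `V × V`. -/
def tensorM (ν ρ : Measure V) : Measure (Phase V) := (ν.prod ρ).map (WithLp.toLp 2)

lemma sigmaFinite_of_hasTemperateGrowth (ν : Measure V) [ν.HasTemperateGrowth] :
    SigmaFinite ν := by
  obtain ⟨n, hn⟩ := (inferInstance : ν.HasTemperateGrowth).exists_integrable
  refine ⟨⟨⟨fun m => Metric.closedBall 0 m, fun _ => trivial, fun m => ?_,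
    Metric.iUnion_closedBall_nat 0⟩⟩⟩
  have hpos : (0 : ℝ) < (1 + (m : ℝ)) ^ (-(n : ℝ)) := by positivity
  refine (measure_mono fun x hx => ?_).trans_lt (hn.measure_norm_ge_lt_top hpos)
  rw [Metric.mem_closedBall, dist_zero_right] at hx
  rw [Set.mem_ofPred_eq, Real.norm_of_nonneg (by positivity)]
  exact Real.rpow_le_rpow_of_nonpos (by positivity) (by linarith) (by simp)

instance [BorelSpace V] (ν : Measure V) [ν.HasTemperateGrowth] :
    (reflectM ν).HasTemperateGrowth := by
  obtain ⟨n, hn⟩ := (inferInstance : ν.HasTemperateGrowth).exists_integrable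
  refine ⟨n, ?_⟩
  rw [reflectM, show (fun x : V => -x) = MeasurableEquiv.neg V from rfl,
    (MeasurableEquiv.neg V).measurableEmbedding.integrable_map_iff]
  simpa [Function.comp_def] using hn

instance [BorelSpace V] [SecondCountableTopology V] (ν ρ : Measure V) [ν.HasTemperateGrowth]
    [ρ.HasTemperateGrowth] : (tensorM ν ρ).HasTemperateGrowth := by
  obtain ⟨n, hn⟩ := (inferInstance : ν.HasTemperateGrowth).exists_integrable
  obtain ⟨m, hm⟩ := (inferInstance : ρ.HasTemperateGrowth).exists_integrable
  have := sigmaFinite_of_hasTemperateGrowth ν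
  have := sigmaFinite_of_hasTemperateGrowth ρ
  refine ⟨n + m, ?_⟩
  rw [tensorM, ← MeasurableEquiv.coe_toLp,
    (MeasurableEquiv.toLp 2 (V × V)).measurableEmbedding.integrable_map_iff]
  have hc : Continuous (fun p : V × V => (1 + ‖pt p.1 p.2‖) ^ (-((n + m : ℕ) : ℝ))) := by
    refine Continuous.rpow_const ?_ (fun p => Or.inl (by positivity))
    exact continuous_const.add ((WithLp.prodContinuousLinearEquiv 2 ℝ V V).symm.continuous.norm)
  refine (hn.mul_prod hm).mono' hc.aestronglyMeasurable (.of_forall fun p => ?_)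
  have h1 : ‖p.1‖ ≤ ‖pt p.1 p.2‖ := WithLp.norm_fst_le (x := pt p.1 p.2)
  have h2 : ‖p.2‖ ≤ ‖pt p.1 p.2‖ := WithLp.norm_snd_le (x := pt p.1 p.2)
  have e : (-((n + m : ℕ) : ℝ)) = -(n : ℝ) + -(m : ℝ) := by push_cast; ring
  change ‖(1 + ‖pt p.1 p.2‖) ^ (-((n + m : ℕ) : ℝ))‖ ≤ _
  rw [Real.norm_of_nonneg (by positivity), e, Real.rpow_add (by positivity)]
  gcongr ?_ * ?_
  · exact Real.rpow_le_rpow_of_nonpos (by positivity) (by linarith) (by simp)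
  · exact Real.rpow_le_rpow_of_nonpos (by positivity) (by linarith) (by simp)

end Distributions

section Processes

variable {Ω : Type*} [MeasurableSpace Ω]
  {V : Type} [NormedAddCommGroup V] [InnerProductSpace ℝ V]

/-- Tempered generalized stochastic processes: continuous antilinear maps `𝓢(V) → L²(Ω)`. -/
abbrev GSP (P : Measure Ω) (V : Type) [NormedAddCommGroup V] [InnerProductSpace ℝ V] : Type _ :=
  𝓢(V, ℂ) →L⋆[ℂ] Lp ℂ 2 P

variable {P : Measure Ω}

/-- The values of the process have mean zero. -/
def IsZeroMean (u : GSP P V) : Prop := ∀ φ, ∫ w, u φ w ∂P = 0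

/-- All real random vectors consisting of real and imaginary parts of `(u, φ₁), …, (u, φₙ)` are
(possibly degenerate) Gaussian vectors. -/
def IsGaussianGSP (u : GSP P V) : Prop :=
  ∀ (n : ℕ) (φ : Fin n → 𝓢(V, ℂ)),
    ProbabilityTheory.IsGaussian (P.map fun w =>
      (Sum.elim (fun j => (u (φ j) w).re) (fun j => (u (φ j) w).im) : Fin n ⊕ Fin n → ℝ))

/-- `λ u` and `u` have the same finite dimensional laws whenever `|λ| = 1`. -/
def IsSymmetricGSP (u : GSP P V) : Prop :=
  ∀ c : ℂ, ‖c‖ = 1 → ∀ (n : ℕ) (φ : Fin n → 𝓢(V, ℂ)),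
    P.map (fun w j => c * u (φ j) w) = P.map (fun w j => u (φ j) w)

/-- The covariance operator `𝓢(V) → 𝓢'(V)`,
`(K_u ψ, φ) = (k_u, φ ⊗ ψ̄) = E((u, φ) conj (u, ψ))`; see `covOp_apply`. -/
def covOp (u : GSP P V) : 𝓢(V, ℂ) →ₗ[ℂ] TempDist V where
  toFun ψ := (innerSL ℂ (u ψ)).comp u
  map_add' ψ₁ ψ₂ := by ext φ; simp
  map_smul' c ψ := by ext φ; simp

lemma covOp_apply (u : GSP P V) (φ ψ : 𝓢(V, ℂ)) :
    covOp u ψ φ = ∫ w, u φ w * starRingEnd ℂ (u ψ w) ∂P := by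
  change inner ℂ (u ψ) (u φ) = _
  rw [L2.inner_def]
  rfl

/-- Stationarity: constant mean and translation invariant covariance. -/
def IsStationary [MeasurableSpace V] [BorelSpace V] [FiniteDimensional ℝ V] (u : GSP P V) :
    Prop :=
  (∃ c : ℂ, ∀ φ : 𝓢(V, ℂ), ∫ w, u φ w ∂P = c * ∫ x, starRingEnd ℂ (φ x)) ∧
    ∀ (x : V) (φ ψ : 𝓢(V, ℂ)), covOp u (translS x ψ) (translS x φ) = covOp u ψ φ

variable [FiniteDimensional ℝ V] [MeasurableSpace V] [BorelSpace V]

/-- The Fourier transform of a tempered distribution, `(T̂, φ̂) = (T, φ)`. -/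
def fourierD (T : TempDist V) : TempDist V :=
  T.comp (fourierS (V := V)).symm.toContinuousLinearMap

/-- The Fourier transform of a process, `(û, φ̂) = (u, φ)`. -/
def fourierGSP (u : GSP P V) : GSP P V :=
  u.comp (fourierS (V := V)).symm.toContinuousLinearMap

lemma fourierD_apply (T : TempDist V) (φ : 𝓢(V, ℂ)) : fourierD T (fourierS φ) = T φ := by
  simp [fourierD]

lemma fourierGSP_apply (u : GSP P V) (φ : 𝓢(V, ℂ)) : fourierGSP u (fourierS φ) = u φ := by
  simp [fourierGSP]

/-- A process is frequency stationary if its Fourier transform is stationary. -/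
def IsFrequencyStationary (u : GSP P V) : Prop := IsStationary (fourierGSP u)

/-- `ψ*(x) = conj (ψ(-x))`. -/
def starS (ψ : 𝓢(V, ℂ)) : 𝓢(V, ℂ) := conjS (compS (ContinuousLinearEquiv.neg ℝ) ψ)

lemma starS_apply (ψ : 𝓢(V, ℂ)) (x : V) : starS ψ x = starRingEnd ℂ (ψ (-x)) := rfl

/-- Convolution of Schwartz functions. -/
def convS (φ ψ : 𝓢(V, ℂ)) : 𝓢(V, ℂ) :=
  SchwartzMap.convolution (ContinuousLinearMap.mul ℂ ℂ) φ ψ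

lemma convS_apply (φ ψ : 𝓢(V, ℂ)) (x : V) : convS φ ψ x = ∫ y, φ y * ψ (x - y) := by
  rw [convS, SchwartzMap.convolution_apply]; rfl

/-- `μ` is the spectral measure of `v`: there is a tempered distribution `h` such that
`(k_v, φ ⊗ ψ̄) = (h, φ * ψ*)` for all test functions, and `μ = (2π)^(n/2) ĥ`. -/
def IsSpectralMeasure (v : GSP P V) (μ : Measure V) [μ.HasTemperateGrowth] : Prop :=
  ∃ h : TempDist V, (∀ φ ψ : 𝓢(V, ℂ), covOp v ψ φ = h (convS φ (starS ψ))) ∧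
    measureD μ = (fourierConst V)⁻¹ • fourierD h

/-- `σ ∈ 𝓢'(V × V)` is the Weyl symbol of the operator `K : 𝓢(V) → 𝓢'(V)`:
`(K f, g) = (2π)^(-n/2) (σ, W(g, f))`. -/
def IsWeylSymbol (σ : TempDist (Phase V)) (K : 𝓢(V, ℂ) →ₗ[ℂ] TempDist V) : Prop :=
  ∀ f g : 𝓢(V, ℂ), K f g = fourierConst V * σ (crossWigner g f)

/-- `U` is the process `u ⊗ ū` on `V × V`: `(U, φ ⊗ ψ̄) = (u, φ) conj (u, ψ)` almost surely. -/
def IsTensorSquare (u : GSP P V) (U : GSP P (Phase V)) : Prop :=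
  ∀ φ ψ : 𝓢(V, ℂ), ∀ᵐ w ∂P, U (tensorConj φ ψ) w = u φ w * starRingEnd ℂ (u ψ w)

/-- The process `Φ ↦ (U, (𝓕₂⁻¹ Φ) ∘ κ⁻¹)`. For `U = u ⊗ ū` it is the Wigner distribution `W(u)`,
and for `U₀ = U - E U` it is the zero mean Wigner distribution `W₀(u)`. -/
def wigner (U : GSP P (Phase V)) : GSP P (Phase V) :=
  U.comp ((compS (kappa V).symm).comp partialFourierInv)

end Processes

section Mean

variable {Ω : Type*} [MeasurableSpace Ω] {P : Measure Ω} [IsProbabilityMeasure P]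
  {V : Type} [NormedAddCommGroup V] [InnerProductSpace ℝ V]

/-- The mean `E u`, the tempered distribution `(E u, φ) = E (u, φ)`; see `meanD_apply`. -/
def meanD (u : GSP P V) : TempDist V := (innerSL ℂ (Lp.const 2 P (1 : ℂ))).comp u

lemma meanD_apply (u : GSP P V) (φ : 𝓢(V, ℂ)) : meanD u φ = ∫ w, u φ w ∂P := by
  change inner ℂ (Lp.const 2 P (1 : ℂ)) (u φ) = _
  rw [L2.inner_def]
  refine integral_congr_ae ?_
  filter_upwards [Lp.coeFn_const 2 P (1 : ℂ)] with w h
  rw [h]; simp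

/-- The centered process `u - E u`. -/
def centered (u : GSP P V) : GSP P V :=
  u - (ContinuousLinearMap.toSpanSingleton ℂ (Lp.const 2 P (1 : ℂ))).comp (meanD u)

lemma centered_apply (u : GSP P V) (φ : 𝓢(V, ℂ)) :
    ∀ᵐ w ∂P, centered u φ w = u φ w - meanD u φ := by
  have h : centered u φ = u φ - meanD u φ • Lp.const 2 P (1 : ℂ) := rfl
  rw [h]
  filter_upwards [Lp.coeFn_sub (u φ) (meanD u φ • Lp.const 2 P (1 : ℂ)),
    Lp.coeFn_smul (meanD u φ) (Lp.const 2 P (1 : ℂ)), Lp.coeFn_const 2 P (1 : ℂ)] with w h1 h2 h3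
  rw [h1, Pi.sub_apply, h2, Pi.smul_apply, h3]
  simp

end Mean

end WignerGSP

end

open WignerGSP

noncomputable section

/-! The law of `u` is governed by one measure. Since `û` has spectral measure `μ`, its covariance is
the pairing of Fourier transforms in `L²(μ)`. Applying this to Fourier transforms, and using that
the Fourier transform squares to the reflection, shows that `u` itself has the covariance of
`L²(ν)`, with `ν` the reflection of `μ` (`covOp_eq_integral`): the covariance operator of `u` is
multiplication by `ν`.

Symmetry makes every `(u, φ)` a circular Gaussian variable, so fourth moments obey Wick's rule with
two pairings (`integral_four`). For `(u, φ) conj (u, ψ)` one pairing is the product of the means and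
the other is the inner product of `L²(ν ⊗ ν)`. Hence the second moments of combinations of these
products are a continuous form in the corresponding test function on `V × V`. As tensors are total
in the Schwartz space (`dense_span_tensorConj`), `u ⊗ ū` exists and is unique; its mean is `ν` on
the diagonal and its centered covariance is that of `L²(ν ⊗ ν)` (`exists_isTensorSquare`).

Everything else is transported by `Φ ↦ (𝓕₂⁻¹ Φ) ∘ κ⁻¹`. On the diagonal this map integrates out the
frequency, which gives the mean `(2π)^(-d/2) ν ⊗ 1`. For the Weyl symbol, integrating a cross-Wigner
distribution over `x₂` and `ξ₁` leaves a product of two partial Fourier transforms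
(`integral_crossWigner`), and these are values of the transported test functions
(`isWeylSymbol_symbolD`). The symbol is constant in `x₂` and `ξ₁`; correspondingly the translations
and modulations in question become multiplications by unimodular functions, which cancel in an `L²`
pairing. -/

namespace WignerGSP

set_option linter.unusedSectionVars false
set_option linter.unnecessarySeqFocus false

/-! ### Weighted derivatives of translates and of convolutions -/

section Density

variable {E : Type} [NormedAddCommGroup E] [InnerProductSpace ℝ E]

/-- The space of values of an `n`-th derivative. -/
def JetVal (E : Type) [NormedAddCommGroup E] [InnerProductSpace ℝ E] (n : ℕ) : Type :=
  E [×n]→L[ℝ] ℂ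

instance (n : ℕ) : NormedAddCommGroup (JetVal E n) :=
  inferInstanceAs (NormedAddCommGroup (E [×n]→L[ℝ] ℂ))

instance (n : ℕ) : NormedSpace ℝ (JetVal E n) :=
  inferInstanceAs (NormedSpace ℝ (E [×n]→L[ℝ] ℂ))

instance (n : ℕ) : NormedSpace ℂ (JetVal E n) :=
  inferInstanceAs (NormedSpace ℂ (E [×n]→L[ℝ] ℂ))

instance (n : ℕ) : IsScalarTower ℝ ℂ (JetVal E n) :=
  inferInstanceAs (IsScalarTower ℝ ℂ (E [×n]→L[ℝ] ℂ))

instance (n : ℕ) : CompleteSpace (JetVal E n) :=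
  inferInstanceAs (CompleteSpace (E [×n]→L[ℝ] ℂ))

/-- The `n`-th derivative. -/
def deriv' (n : ℕ) (f : E → ℂ) (x : E) : JetVal E n := iteratedFDeriv ℝ n f x

lemma norm_deriv' (n : ℕ) (f : E → ℂ) (x : E) : ‖deriv' n f x‖ = ‖iteratedFDeriv ℝ n f x‖ := rfl

lemma norm_fderiv_deriv' (n : ℕ) (f : E → ℂ) (x : E) :
    ‖fderiv ℝ (deriv' n f) x‖ = ‖iteratedFDeriv ℝ (n + 1) f x‖ :=
  norm_fderiv_iteratedFDeriv

lemma contDiff_deriv' (n : ℕ) (f : 𝓢(E, ℂ)) : ContDiff ℝ 1 (deriv' n f) :=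
  (f.smooth ⊤).iteratedFDeriv_right (m := 1) (mod_cast le_top)

/-- The currying isomorphism between derivatives of values of `n`-th derivatives and values of
derivatives of order `n + 1`. -/
def curryJet (E : Type) [NormedAddCommGroup E] [InnerProductSpace ℝ E] (n : ℕ) :
    (E →L[ℝ] JetVal E n) ≃L[ℝ] JetVal E (n + 1) :=
  (continuousMultilinearCurryLeftEquiv ℝ (fun _ : Fin (n + 1) => E)
    ℂ).symm.toContinuousLinearEquiv

lemma deriv'_succ (n : ℕ) (f : E → ℂ) (x : E) :
    deriv' (n + 1) f x = curryJet E n (fderiv ℝ (deriv' n f) x) :=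
  congrFun iteratedFDeriv_succ_eq_comp_left x

lemma norm_weighted_deriv'_le (k n : ℕ) (f : 𝓢(E, ℂ)) (x : E) :
    ‖(1 + ‖x‖) ^ k • deriv' n f x‖
      ≤ 2 ^ k * ((Finset.Iic (k, n)).sup (schwartzSeminormFamily ℂ E ℂ)) f := by
  rw [norm_smul, Real.norm_of_nonneg (by positivity)]
  exact one_add_le_sup_seminorm_apply (𝕜 := ℂ) (m := (k, n)) le_rfl le_rfl f x

lemma continuous_deriv' (n : ℕ) (f : 𝓢(E, ℂ)) : Continuous (deriv' n f) :=
  (f.smooth ⊤).continuous_iteratedFDeriv (mod_cast le_top)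

/-- The weighted `n`-th derivative `(1 + |x|)ᵏ Dⁿ f(x)` as a bounded continuous function. -/
def jetFun (k n : ℕ) (f : 𝓢(E, ℂ)) : BoundedContinuousFunction E (JetVal E n) :=
  .ofNormedAddCommGroup (fun x => (1 + ‖x‖) ^ k • deriv' n f x)
    (Continuous.smul (f := fun x : E => (1 + ‖x‖) ^ k) (by fun_prop) (continuous_deriv' n f))
    _ (norm_weighted_deriv'_le k n f)

lemma jetFun_apply (k n : ℕ) (f : 𝓢(E, ℂ)) (x : E) :
    jetFun k n f x = (1 + ‖x‖) ^ k • deriv' n f x := rfl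

/-- `jetFun` as a continuous linear map. -/
def jet (E : Type) [NormedAddCommGroup E] [InnerProductSpace ℝ E] (k n : ℕ) :
    𝓢(E, ℂ) →L[ℂ] BoundedContinuousFunction E (JetVal E n) :=
  mkCLMtoNormedSpace (jetFun k n)
    (fun f g => by
      ext1 x
      have h : deriv' n (f + g : 𝓢(E, ℂ)) x = deriv' n f x + deriv' n g x :=
        iteratedFDeriv_add_apply (f.smooth n).contDiffAt (g.smooth n).contDiffAt
      rw [BoundedContinuousFunction.add_apply, jetFun_apply, jetFun_apply, jetFun_apply,
        ← smul_add, ← h])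
    (fun a f => by
      ext1 x
      have h : deriv' n (a • f : 𝓢(E, ℂ)) x = a • deriv' n f x :=
        iteratedFDeriv_const_smul_apply (f.smooth n).contDiffAt
      rw [RingHom.id_apply, BoundedContinuousFunction.smul_apply, jetFun_apply, jetFun_apply,
        smul_comm a, ← h])
    ⟨Finset.Iic (k, n), 2 ^ k, by positivity, fun f =>
      BoundedContinuousFunction.norm_ofNormedAddCommGroup_le _ (by positivity)
        (norm_weighted_deriv'_le k n f)⟩

lemma jet_apply (k n : ℕ) (f : 𝓢(E, ℂ)) (x : E) :
    jet E k n f x = (1 + ‖x‖) ^ k • deriv' n f x := rfl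

lemma weighted_norm_le_jet (k n : ℕ) (f : 𝓢(E, ℂ)) (x : E) :
    (1 + ‖x‖) ^ k * ‖iteratedFDeriv ℝ n f x‖ ≤ ‖jet E k n f‖ := by
  have h := (jet E k n f).norm_coe_le_norm x
  rwa [jet_apply, norm_smul, Real.norm_of_nonneg (by positivity)] at h

lemma seminorm_le_norm_jet (k n : ℕ) (f : 𝓢(E, ℂ)) :
    schwartzSeminormFamily ℂ E ℂ (k, n) f ≤ ‖jet E k n f‖ := by
  refine SchwartzMap.seminorm_le_bound ℂ k n f (norm_nonneg _) fun x => ?_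
  refine le_trans ?_ (weighted_norm_le_jet k n f x)
  gcongr
  linarith

lemma deriv'_translS (n : ℕ) (f : 𝓢(E, ℂ)) (z x : E) :
    deriv' n (translS z f) x = deriv' n f (x - z) :=
  iteratedFDeriv_comp_sub n z x

/-- The weight is submultiplicative, so a translation costs only a polynomial factor, which a
Schwartz density in `z` absorbs. -/
lemma norm_jet_translS_le (k n : ℕ) (f : 𝓢(E, ℂ)) (z : E) :
    ‖jet E k n (translS z f)‖ ≤ (1 + ‖z‖) ^ k * ‖jet E k n f‖ := by
  refine (BoundedContinuousFunction.norm_le (by positivity)).2 fun x => ?_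
  have h := weighted_norm_le_jet k n f (x - z)
  rw [jet_apply, norm_smul, Real.norm_of_nonneg (by positivity), deriv'_translS, norm_deriv']
  have h1 : 1 + ‖x‖ ≤ (1 + ‖z‖) * (1 + ‖x - z‖) := by
    have := norm_add_le (x - z) z
    rw [sub_add_cancel] at this
    nlinarith [norm_nonneg z, norm_nonneg (x - z)]
  calc (1 + ‖x‖) ^ k * ‖iteratedFDeriv ℝ n f (x - z)‖
      ≤ ((1 + ‖z‖) * (1 + ‖x - z‖)) ^ k * ‖iteratedFDeriv ℝ n f (x - z)‖ := by gcongr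
    _ = (1 + ‖z‖) ^ k * ((1 + ‖x - z‖) ^ k * ‖iteratedFDeriv ℝ n f (x - z)‖) := by
        rw [mul_pow]; ring
    _ ≤ _ := by gcongr

/-- Mean value inequality for the `n`-th derivative on the segment from `x` to `x - z`. Points of
the segment are within distance `1` of `x`, so there the weight changes by a factor of at most `2 ^
k`. -/
lemma norm_jet_translS_sub_le (k n : ℕ) (f : 𝓢(E, ℂ)) (z : E) (hz : ‖z‖ ≤ 1) :
    ‖jet E k n (translS z f - f)‖ ≤ 2 ^ k * ‖jet E k (n + 1) f‖ * ‖z‖ := by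
  refine (BoundedContinuousFunction.norm_le (by positivity)).2 fun x => ?_
  rw [map_sub, BoundedContinuousFunction.sub_apply, jet_apply, jet_apply, ← smul_sub, norm_smul,
    Real.norm_of_nonneg (by positivity), deriv'_translS]
  have hd : ∀ y ∈ segment ℝ x (x - z), ‖fderiv ℝ (iteratedFDeriv ℝ n f) y‖
      ≤ 2 ^ k * ‖jet E k (n + 1) f‖ / (1 + ‖x‖) ^ k := by
    intro y hy
    have hxy : ‖x‖ ≤ ‖y‖ + 1 := by
      obtain ⟨t, ht, rfl⟩ := (segment_eq_image' ℝ x (x - z)) ▸ hy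
      have h1 := norm_sub_le (x + t • (x - z - x)) (t • (x - z - x))
      rw [add_sub_cancel_right] at h1
      have h2 : ‖t • (x - z - x)‖ ≤ 1 := by
        rw [norm_smul, Real.norm_of_nonneg ht.1]
        have : ‖x - z - x‖ = ‖z‖ := by rw [show x - z - x = -z by abel, norm_neg]
        rw [this]
        exact mul_le_one₀ ht.2 (norm_nonneg _) hz
      linarith
    have h := weighted_norm_le_jet k (n + 1) f y
    rw [norm_fderiv_iteratedFDeriv, le_div_iff₀ (by positivity)]
    have h3 : (1 + ‖x‖) ^ k ≤ 2 ^ k * (1 + ‖y‖) ^ k := by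
      rw [← mul_pow]
      gcongr
      linarith [norm_nonneg y]
    calc ‖iteratedFDeriv ℝ (n + 1) f y‖ * (1 + ‖x‖) ^ k
        ≤ ‖iteratedFDeriv ℝ (n + 1) f y‖ * (2 ^ k * (1 + ‖y‖) ^ k) := by gcongr
      _ = 2 ^ k * ((1 + ‖y‖) ^ k * ‖iteratedFDeriv ℝ (n + 1) f y‖) := by ring
      _ ≤ _ := by gcongr
  have hdiff : ∀ y ∈ segment ℝ x (x - z), DifferentiableAt ℝ (iteratedFDeriv ℝ n f) y := fun y _ =>
    ((f.smooth ⊤).differentiable_iteratedFDeriv (mod_cast WithTop.coe_lt_top _)) y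
  have h := (convex_segment x (x - z)).norm_image_sub_le_of_norm_fderiv_le hdiff hd
    (left_mem_segment ℝ x (x - z)) (right_mem_segment ℝ x (x - z))
  have hz' : ‖x - z - x‖ = ‖z‖ := by rw [show x - z - x = -z by abel, norm_neg]
  rw [hz'] at h
  calc (1 + ‖x‖) ^ k * ‖iteratedFDeriv ℝ n f (x - z) - iteratedFDeriv ℝ n f x‖
      ≤ (1 + ‖x‖) ^ k * (2 ^ k * ‖jet E k (n + 1) f‖ / (1 + ‖x‖) ^ k * ‖z‖) := by gcongr
    _ = _ := by field_simp

lemma continuous_jet_translS (k n : ℕ) (f : 𝓢(E, ℂ)) :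
    Continuous fun z => jet E k n (translS z f) := by
  refine continuous_iff_continuousAt.2 fun z₀ => ?_
  rw [ContinuousAt, tendsto_iff_norm_sub_tendsto_zero]
  set C := 2 ^ k * ‖jet E k (n + 1) f‖ * (1 + ‖z₀‖) ^ k
  have h1 : Filter.Tendsto (fun z => C * ‖z - z₀‖) (nhds z₀) (nhds 0) := by
    have : Continuous fun z => C * ‖z - z₀‖ := by fun_prop
    simpa using this.tendsto z₀
  refine squeeze_zero' (.of_forall fun _ => norm_nonneg _) ?_ h1
  filter_upwards [Metric.ball_mem_nhds z₀ one_pos] with z hz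
  -- Continuity at `z₀` is reduced to continuity at `0`, at the price of the polynomial factor in
  -- `z₀`.
  have e : translS z f - translS z₀ f = translS z₀ (translS (z - z₀) f - f) := by
    ext x
    simp
  rw [← map_sub, e]
  refine (norm_jet_translS_le k n _ z₀).trans ?_
  have := norm_jet_translS_sub_le k n f (z - z₀) (by
    rw [← dist_eq_norm]; exact (Metric.mem_ball.1 hz).le)
  calc (1 + ‖z₀‖) ^ k * ‖jet E k n (translS (z - z₀) f - f)‖
      ≤ (1 + ‖z₀‖) ^ k * (2 ^ k * ‖jet E k (n + 1) f‖ * ‖z - z₀‖) := by gcongr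
    _ = _ := by ring

variable [FiniteDimensional ℝ E] [MeasurableSpace E] [BorelSpace E]

lemma hasFDerivAt_integral_smul_sub {G : Type} [NormedAddCommGroup G] [NormedSpace ℝ G]
    [NormedSpace ℂ G] [IsScalarTower ℝ ℂ G]
    {f : E → ℂ} (hf : Integrable f) {h : E → G} (hh : ContDiff ℝ 1 h) {C C' : ℝ}
    (hC : ∀ x, ‖h x‖ ≤ C) (hC' : ∀ x, ‖fderiv ℝ h x‖ ≤ C') (x : E) :
    HasFDerivAt (fun x => ∫ z, f z • h (x - z)) (∫ z, f z • fderiv ℝ h (x - z)) x := by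
  have hm : ∀ y, AEStronglyMeasurable (fun z => h (y - z)) (volume : Measure E) := fun y =>
    (hh.continuous.comp (by fun_prop)).aestronglyMeasurable
  refine hasFDerivAt_integral_of_dominated_of_fderiv_le (μ := (volume : Measure E))
    (𝕜 := ℝ) (x₀ := x) (s := Set.univ) (F := fun y z => f z • h (y - z))
    (F' := fun y z => f z • fderiv ℝ h (y - z))
    (bound := fun z => ‖f z‖ * C') Filter.univ_mem
    (.of_forall fun y => hf.aestronglyMeasurable.smul (hm y)) ?_ ?_ ?_ (hf.norm.mul_const _) ?_
  · refine (hf.norm.mul_const C).mono' (hf.aestronglyMeasurable.smul (hm x)) (.of_forall fun z => ?_)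
    rw [norm_smul]
    gcongr
    exact hC _
  · exact hf.aestronglyMeasurable.smul
      (((hh.continuous_fderiv one_ne_zero).comp (by fun_prop)).aestronglyMeasurable)
  · refine .of_forall fun z y _ => ?_
    rw [norm_smul]
    gcongr
    exact hC' _
  · refine .of_forall fun z y _ => ?_
    have h1 : HasFDerivAt h (fderiv ℝ h (y - z)) (y - z) :=
      (hh.differentiable one_ne_zero _).hasFDerivAt
    have h2 : HasFDerivAt (fun y => h (y - z)) (fderiv ℝ h (y - z)) y := by
      simpa [Function.comp_def] using h1.comp y ((hasFDerivAt_id y).sub_const z)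
    exact h2.const_smul (f z)

/-- All derivatives of a convolution can be put on the Schwartz factor; the other factor need only
be integrable. The induction differentiates under the integral, using that each derivative of `h` is
bounded. -/
lemma deriv'_integral_smul_sub {f : E → ℂ} (hf : Integrable f) (h : 𝓢(E, ℂ)) (n : ℕ) :
    deriv' n (fun x => ∫ z, f z • h (x - z)) = fun x => ∫ z, f z • deriv' n h (x - z) := by
  induction n with
  | zero =>
    funext x
    let e : ℂ ≃L[ℝ] JetVal E 0 :=
      (continuousMultilinearCurryFin0 ℝ E ℂ).symm.toContinuousLinearEquiv
    have := e.integral_comp_comm (μ := volume) fun z => f z • h (x - z)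
    refine this.symm.trans (integral_congr_ae (.of_forall fun z => ?_))
    apply ContinuousMultilinearMap.ext
    intro m
    rfl
  | succ n ih =>
    funext x
    have hb : ∀ m, ∀ x, ‖iteratedFDeriv ℝ m h x‖ ≤ SchwartzMap.seminorm ℝ 0 m h := fun m x =>
      h.norm_iteratedFDeriv_le_seminorm ℝ m x
    have h1 := hasFDerivAt_integral_smul_sub hf (contDiff_deriv' n h) (hb n)
      (fun x => (norm_fderiv_deriv' n h x).trans_le (hb _ x)) x
    rw [deriv'_succ, ih, h1.fderiv, ← ContinuousLinearEquiv.integral_comp_comm]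
    refine integral_congr_ae (.of_forall fun z => ?_)
    simp only [deriv'_succ]
    apply ContinuousMultilinearMap.ext
    intro m
    rfl

end Density

/-! ### Convolutions as vector-valued integrals; density by approximate identities -/

section ConvolutionSwap

variable {E : Type} [NormedAddCommGroup E] [InnerProductSpace ℝ E]
  [FiniteDimensional ℝ E] [MeasurableSpace E] [BorelSpace E]

/-- The jets in a finite set of orders. -/
def jets (s : Finset (ℕ × ℕ)) :
    𝓢(E, ℂ) →L[ℂ] ((i : s) → BoundedContinuousFunction E (JetVal E i.1.2)) :=
  ContinuousLinearMap.pi fun i => jet E i.1.1 i.1.2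

lemma continuous_jets_translS (s : Finset (ℕ × ℕ)) (f : 𝓢(E, ℂ)) :
    Continuous fun z => jets s (translS z f) :=
  continuous_pi fun i => continuous_jet_translS i.1.1 i.1.2 f

/-- The translate `translS z g` grows polynomially in `z` in each weighted norm, and `f` decays
rapidly. The Bochner integral then takes place in a Banach space, although the Schwartz space is not
one. -/
lemma integrable_smul_jets_translS (s : Finset (ℕ × ℕ)) (f g : 𝓢(E, ℂ)) :
    Integrable fun z => f z • jets s (translS z g) := by
  refine Integrable.of_eval fun i => ?_
  have h1 : Integrable fun z => ‖f z‖ * (1 + ‖z‖) ^ i.1.1 := by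
    refine (((f.integrable_pow_mul (volume) i.1.1).add f.integrable.norm).const_mul
      (2 ^ i.1.1)).mono' ?_ (.of_forall fun z => ?_)
    · exact (Continuous.mul f.continuous.norm (by fun_prop)).aestronglyMeasurable
    · rw [Real.norm_of_nonneg (by positivity)]
      have h2 : (1 + ‖z‖) ^ i.1.1 ≤ 2 ^ i.1.1 * (‖z‖ ^ i.1.1 + 1) := by
        refine (add_pow_le zero_le_one (norm_nonneg z) _).trans ?_
        rw [one_pow, add_comm]
        gcongr
        · norm_num
        · omega
      calc ‖f z‖ * (1 + ‖z‖) ^ i.1.1 ≤ ‖f z‖ * (2 ^ i.1.1 * (‖z‖ ^ i.1.1 + 1)) := by gcongr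
        _ = _ := by simp only [Pi.add_apply]; ring
  refine (h1.mul_const ‖jet E i.1.1 i.1.2 g‖).mono' ?_ (.of_forall fun z => ?_)
  · exact (f.continuous.smul (continuous_jet_translS i.1.1 i.1.2 g)).aestronglyMeasurable
  · change ‖f z • jet E i.1.1 i.1.2 (translS z g)‖ ≤ _
    rw [norm_smul, mul_assoc]
    gcongr
    exact norm_jet_translS_le _ _ _ _

lemma integral_smul_jets_apply (s : Finset (ℕ × ℕ)) (f g : 𝓢(E, ℂ)) (i : s) (x : E) :
    (∫ z, f z • jets s (translS z g)) i x
      = (1 + ‖x‖) ^ i.1.1 • ∫ z, f z • deriv' i.1.2 g (x - z) := by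
  let L : ((i : s) → BoundedContinuousFunction E (JetVal E i.1.2)) →L[ℝ] JetVal E i.1.2 :=
    (BoundedContinuousFunction.evalCLM ℝ x).comp (ContinuousLinearMap.proj i)
  have h := L.integral_comp_comm (integrable_smul_jets_translS s f g)
  change L (∫ z, f z • jets s (translS z g)) = _
  rw [← h, ← integral_smul]
  refine integral_congr_ae (.of_forall fun z => ?_)
  change f z • jet E i.1.1 i.1.2 (translS z g) x = _
  rw [jet_apply, deriv'_translS]
  exact smul_comm _ _ _

/-- Commutativity of convolution: pointwise, both sides are weighted derivatives of the same
function. One side averages translates of `g`, the other translates of `f`, and the density argument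
plays one reading against the other. -/
lemma integral_smul_jets_swap (s : Finset (ℕ × ℕ)) (f g : 𝓢(E, ℂ)) :
    ∫ z, f z • jets s (translS z g) = ∫ z, g z • jets s (translS z f) := by
  funext i
  apply BoundedContinuousFunction.ext
  intro x
  rw [integral_smul_jets_apply, integral_smul_jets_apply]
  have h1 := congrFun (deriv'_integral_smul_sub f.integrable g i.1.2) x
  have h2 := congrFun (deriv'_integral_smul_sub g.integrable f i.1.2) x
  rw [← h1, ← h2]
  congr 2
  funext y
  rw [← integral_sub_left_eq_self _ _ y]
  simp [mul_comm]

/-- The quotient by a closed subspace is normed, and the continuous quotient map commutes with the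
integral and kills the integrand. -/
lemma integral_mem_of_isClosed {α B : Type} [MeasurableSpace α] {ν : Measure α}
    [NormedAddCommGroup B] [NormedSpace ℂ B] [NormedSpace ℝ B] [IsScalarTower ℝ ℂ B]
    [CompleteSpace B]
    {K : Submodule ℂ B} (hK : IsClosed (K : Set B)) {v : α → B} (hv : Integrable v ν)
    (h : ∀ a, v a ∈ K) : ∫ a, v a ∂ν ∈ K := by
  have : IsClosed (K : Set B) := hK
  have h1 := K.mkQL.integral_comp_comm hv
  have h2 : ∀ a, K.mkQL (v a) = 0 := fun a => (Submodule.Quotient.mk_eq_zero K).2 (h a)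
  simp only [h2, integral_zero] at h1
  exact (Submodule.Quotient.mk_eq_zero K).1 h1.symm

/-- A subspace of Schwartz functions containing all translates of an approximate identity
is dense. -/
lemma dense_of_translates {ι : Type} {l : Filter ι} [l.NeBot] (A : Submodule ℂ 𝓢(E, ℂ))
    (φ : ι → 𝓢(E, ℂ)) (ρ : ι → E → ℝ) (hφ : ∀ i x, φ i x = ρ i x) (h0 : ∀ i x, 0 ≤ ρ i x)
    (h1 : ∀ i, ∫ x, ρ i x = 1)
    (hs : Filter.Tendsto (fun i => Function.support (ρ i)) l (nhds 0).smallSets)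
    (hA : ∀ i z, translS z (φ i) ∈ A) : Dense (A : Set 𝓢(E, ℂ)) := by
  intro f
  -- A basic neighbourhood involves finitely many seminorms, all dominated by the norm of `jets s`;
  -- it suffices to approximate `jets s f` in that Banach space.
  rw [mem_closure_iff_nhds_basis (schwartz_withSeminorms ℂ E ℂ).hasBasis_ball]
  rintro ⟨s, r⟩ hr
  set K := (A.map (jets s).toLinearMap).topologicalClosure
  -- After the swap the integrand consists of multiples of translates of `φ i`, which lie in `A`.
  have hK : ∀ i, ∫ z, φ i z • jets s (translS z f) ∈ K := fun i => by
    rw [integral_smul_jets_swap]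
    refine integral_mem_of_isClosed (Submodule.isClosed_topologicalClosure _)
      (integrable_smul_jets_translS s f (φ i)) fun z => K.smul_mem _ ?_
    exact Submodule.le_topologicalClosure _ ⟨_, hA i z, rfl⟩
  have hlim : Filter.Tendsto (fun i => ∫ z, φ i z • jets s (translS z f)) l
      (nhds (jets s f)) := by
    have hc : Continuous fun z => jets s (translS (-z) f) :=
      (continuous_jets_translS s f).comp continuous_neg
    -- The convolution is evaluated at `0`, whence the sign: `z ↦ jets s (translS (-z) f)` at `0 -
    -- z` is the translate by `z`.
    have h := convolution_tendsto_right (μ := (volume : Measure E)) (x₀ := (0 : E)) (z₀ := jets s f)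
      (φ := ρ) (g := fun _ z => jets s (translS (-z) f)) (k := fun _ => 0) (l := l)
      (.of_forall h0) (.of_forall h1) hs (.of_forall fun _ => hc.aestronglyMeasurable) ?_
      tendsto_const_nhds
    · refine h.congr fun i => integral_congr_ae (.of_forall fun z => ?_)
      simp only [hφ, zero_sub, neg_neg, ContinuousLinearMap.lsmul_apply]
      exact (Complex.coe_smul (ρ i z) _).symm
    · have h2 := (hc.tendsto 0).comp (Filter.tendsto_snd (f := l) (g := nhds (0 : E)))
      have h3 : translS (0 : E) f = f := by ext x; simp
      simpa [Function.comp_def, Function.uncurry_def, h3] using h2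
  have hf : jets s f ∈ K :=
    (Submodule.isClosed_topologicalClosure _).mem_of_tendsto hlim (.of_forall hK)
  obtain ⟨_, ⟨t, ht, rfl⟩, htr⟩ := Metric.mem_closure_iff.1 hf r hr
  refine ⟨t, ht, ?_⟩
  rw [Seminorm.mem_ball]
  refine Seminorm.finset_sup_apply_lt hr fun i hi => ?_
  refine (seminorm_le_norm_jet i.1 i.2 _).trans_lt ?_
  rw [dist_comm, dist_eq_norm] at htr
  have h4 := (norm_le_pi_norm (jets s t - jets s f) ⟨i, hi⟩).trans_lt htr
  rw [← map_sub] at h4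
  exact h4

end ConvolutionSwap

/-! ### Totality of tensors in the Schwartz space of the product -/

section DensityTensor

variable {W : Type} [NormedAddCommGroup W] [InnerProductSpace ℝ W]

lemma translS_tensorConj (z : Phase W) (f g : 𝓢(W, ℂ)) :
    translS z (tensorConj f g) = tensorConj (translS z.fst f) (translS z.snd g) := by
  ext p
  rfl

variable [FiniteDimensional ℝ W] [MeasurableSpace W] [BorelSpace W]

/-- A smooth bump function of total mass one, supported in the ball of radius `1 / (n + 1)`. -/
def bump (W : Type) [NormedAddCommGroup W] [InnerProductSpace ℝ W] (n : ℕ) :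
    ContDiffBump (0 : W) where
  rIn := 1 / (n + 2)
  rOut := 1 / (n + 1)
  rIn_pos := by positivity
  rIn_lt_rOut := by gcongr; norm_num

/-- The normalized bump function as a Schwartz function. -/
def bumpS (W : Type) [NormedAddCommGroup W] [InnerProductSpace ℝ W] [FiniteDimensional ℝ W]
    [MeasurableSpace W] [BorelSpace W] (n : ℕ) : 𝓢(W, ℂ) :=
  HasCompactSupport.toSchwartzMap
    (f := fun x => (((bump W n).normed volume x : ℝ) : ℂ))
    ((bump W n).hasCompactSupport_normed.comp_left Complex.ofReal_zero)
    (Complex.ofRealCLM.contDiff.comp (bump W n).contDiff_normed)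

lemma bumpS_apply (n : ℕ) (x : W) : bumpS W n x = ((bump W n).normed volume x : ℝ) := rfl

/-- Products of two bumps form an approximate identity on the product space, and each of their
translates is again a tensor. The conjugation is harmless because the bumps are real. -/
lemma dense_span_tensorConj : Dense (Submodule.span ℂ
    (Set.range fun p : 𝓢(W, ℂ) × 𝓢(W, ℂ) => tensorConj p.1 p.2) : Set 𝓢(Phase W, ℂ)) := by
  refine dense_of_translates (l := Filter.atTop) _ (fun n => tensorConj (bumpS W n) (bumpS W n))
    (fun n p => (bump W n).normed volume p.fst * (bump W n).normed volume p.snd) ?_ ?_ ?_ ?_ ?_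
  · intro n p
    change bumpS W n p.fst * starRingEnd ℂ (bumpS W n p.snd) = _
    simp [bumpS_apply]
  · exact fun n p => mul_nonneg ((bump W n).nonneg_normed _) ((bump W n).nonneg_normed _)
  · intro n
    rw [← (WithLp.volume_preserving_toLp W W).integral_comp
      (MeasurableEquiv.toLp 2 (W × W)).measurableEmbedding]
    change ∫ p : W × W, (bump W n).normed volume p.1 * (bump W n).normed volume p.2 = 1
    rw [Measure.volume_eq_prod, integral_prod_mul, (bump W n).integral_normed, one_mul]
  · rw [Filter.tendsto_smallSets_iff]
    intro t ht
    obtain ⟨ε, hε, hball⟩ := Metric.mem_nhds_iff.1 ht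
    have h1 : Filter.Tendsto (fun n : ℕ => 2 * (1 / ((n : ℝ) + 1))) Filter.atTop (nhds (2 * 0)) :=
      tendsto_one_div_add_atTop_nhds_zero_nat.const_mul 2
    rw [mul_zero] at h1
    filter_upwards [h1.eventually (gt_mem_nhds hε)] with n hn
    intro p hp
    apply hball
    rw [Function.mem_support] at hp
    have h2 : ∀ x : W, (bump W n).normed volume x ≠ 0 → ‖x‖ < 1 / ((n : ℝ) + 1) := fun x hx => by
      have : x ∈ Function.support ((bump W n).normed volume) := hx
      rw [(bump W n).support_normed_eq] at this
      simpa [bump] using this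
    have h3 := h2 _ (left_ne_zero_of_mul hp)
    have h4 := h2 _ (right_ne_zero_of_mul hp)
    rw [mem_ball_zero_iff]
    have h5 : p = pt p.fst 0 + pt 0 p.snd := by apply phase_ext <;> simp
    have h6 := norm_add_le (pt p.fst (0 : W)) (pt (0 : W) p.snd)
    rw [← h5, WithLp.norm_toLp_fst, WithLp.norm_toLp_snd] at h6
    linarith
  · intro n z
    rw [translS_tensorConj]
    exact Submodule.subset_span ⟨(_, _), rfl⟩

end DensityTensor

/-! ### Fourth moments of circular Gaussian variables -/

section FourthMoment

open ProbabilityTheory Complex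

lemma integral_pow_four_gaussianReal (v : NNReal) :
    ∫ x, x ^ 4 ∂gaussianReal 0 v = 3 * (v : ℝ) ^ 2 := by
  have h := iteratedDeriv_mgf_zero (μ := gaussianReal 0 v) (X := id) (by simp) 4
  rw [mgf_id_gaussianReal] at h
  have e0 : ∀ t : ℝ, HasDerivAt (fun t : ℝ => Real.exp (0 * t + v * t ^ 2 / 2))
      (v * t * Real.exp (0 * t + v * t ^ 2 / 2)) t := fun t => by
    have h1 : HasDerivAt (fun t : ℝ => 0 * t + (v : ℝ) * t ^ 2 / 2) (v * t) t := by
      convert! ((hasDerivAt_id t).const_mul (0 : ℝ)).add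
        ((((hasDerivAt_id t).pow 2).const_mul (v : ℝ)).div_const 2) using 1
      simp
      ring
    convert! h1.exp using 1
    ring
  -- Differentiating a polynomial times `exp(v t² / 2)` replaces `p` by `p' + v t p`; four rounds
  -- give the fourth derivative of the moment generating function.
  have ep : ∀ (p p' : ℝ → ℝ), (∀ t, HasDerivAt p (p' t) t) →
      deriv (fun t => p t * Real.exp (0 * t + v * t ^ 2 / 2))
        = fun t => (p' t + v * t * p t) * Real.exp (0 * t + v * t ^ 2 / 2) := fun p p' hp => by
    funext t
    refine HasDerivAt.deriv ?_
    convert! (hp t).mul (e0 t) using 1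
    ring
  have d1 : deriv (fun t : ℝ => Real.exp (0 * t + v * t ^ 2 / 2))
      = fun t => (v * t) * Real.exp (0 * t + v * t ^ 2 / 2) := funext fun t => (e0 t).deriv
  have d2 := ep (fun t => v * t) (fun t => v) fun t => by
    simpa using (hasDerivAt_id t).const_mul (v : ℝ)
  have d3 := ep (fun t => v + v * t * (v * t)) (fun t => 2 * (v : ℝ) ^ 2 * t) fun t => by
    convert! (((hasDerivAt_id t).pow 2).const_mul ((v : ℝ) ^ 2)).const_add (v : ℝ) using 1
    · funext t; simp; ring
    · simp; ring
  have d4 := ep (fun t => 2 * (v : ℝ) ^ 2 * t + v * t * (v + v * t * (v * t)))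
    (fun t => 3 * (v : ℝ) ^ 2 + 3 * (v : ℝ) ^ 3 * t ^ 2) fun t => by
    convert! ((hasDerivAt_id t).const_mul (3 * (v : ℝ) ^ 2)).add
      (((hasDerivAt_id t).pow 3).const_mul ((v : ℝ) ^ 3)) using 1
    · funext t; simp; ring
    · simp; ring
  rw [iteratedDeriv_succ, iteratedDeriv_succ, iteratedDeriv_succ, iteratedDeriv_one, d1, d2, d3,
    d4] at h
  simp only [Pi.pow_apply, id_eq] at h
  rw [← h]
  simp

variable {Ω : Type*} [MeasurableSpace Ω] {P : Measure Ω} [IsProbabilityMeasure P]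

/-- A complex random variable with Gaussian real part whose law is invariant under rotations. -/
structure IsCircularGaussian (P : Measure Ω) (X : Ω → ℂ) : Prop where
  aemeasurable : AEMeasurable X P
  rotate : ∀ c : ℂ, ‖c‖ = 1 → P.map (fun w => c * X w) = P.map X
  gaussian : IsGaussian (P.map fun w => (X w).re)

variable {X : Ω → ℂ}

lemma IsCircularGaussian.map_re_mul (h : IsCircularGaussian P X) {c : ℂ} (hc : ‖c‖ = 1) :
    P.map (fun w => (c * X w).re) = P.map (fun w => (X w).re) := by
  have h1 := congrArg (Measure.map Complex.re) (h.rotate c hc)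
  rwa [AEMeasurable.map_map_of_aemeasurable Complex.measurable_re.aemeasurable
    (h.aemeasurable.const_mul c), AEMeasurable.map_map_of_aemeasurable
    Complex.measurable_re.aemeasurable h.aemeasurable] at h1

lemma IsCircularGaussian.integral_re_mul_pow (h : IsCircularGaussian P X) {c : ℂ} (hc : ‖c‖ = 1)
    (n : ℕ) : ∫ w, (c * X w).re ^ n ∂P = ∫ w, (X w).re ^ n ∂P := by
  have h1 : AEMeasurable (fun w => (c * X w).re) P :=
    Complex.measurable_re.comp_aemeasurable (h.aemeasurable.const_mul c)
  have h2 : AEMeasurable (fun w => (X w).re) P :=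
    Complex.measurable_re.comp_aemeasurable h.aemeasurable
  have e1 := integral_map h1 (f := fun x : ℝ => x ^ n) (by fun_prop)
  have e2 := integral_map h2 (f := fun x : ℝ => x ^ n) (by fun_prop)
  rw [← e1, ← e2, h.map_re_mul hc]

lemma IsCircularGaussian.exists_gaussianReal (h : IsCircularGaussian P X) :
    ∃ v : NNReal, P.map (fun w => (X w).re) = gaussianReal 0 v := by
  -- Invariance under `X ↦ -X` forces the mean to vanish.
  have h1 := h.integral_re_mul_pow (c := -1) (by simp) 1
  simp only [neg_mul, one_mul, neg_re, pow_one, integral_neg] at h1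
  have h2 : ∫ w, (X w).re ∂P = 0 := by linarith
  have h3 := IsGaussian.eq_gaussianReal _ h.gaussian
  refine ⟨Var[id; P.map fun w => (X w).re].toNNReal, ?_⟩
  convert! h3 using 2
  have hm : AEMeasurable (fun w => (X w).re) P :=
    Complex.measurable_re.comp_aemeasurable h.aemeasurable
  rw [integral_map hm (by fun_prop)]
  exact h2.symm

lemma IsCircularGaussian.memLp_re (h : IsCircularGaussian P X) :
    MemLp (fun w => (X w).re) 4 P := by
  obtain ⟨v, hv⟩ := h.exists_gaussianReal
  have h1 := memLp_id_gaussianReal (μ := 0) (v := v) 4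
  rw [← hv] at h1
  exact (memLp_map_measure_iff (by fun_prop)
    (Complex.measurable_re.comp_aemeasurable h.aemeasurable)).1 h1

lemma IsCircularGaussian.mul (h : IsCircularGaussian P X) {c : ℂ} (hc : ‖c‖ = 1) :
    IsCircularGaussian P fun w => c * X w where
  aemeasurable := h.aemeasurable.const_mul c
  rotate b hb := by
    rw [h.rotate c hc]
    simp_rw [← mul_assoc]
    exact h.rotate (b * c) (by simp [hb, hc])
  gaussian := by
    rw [h.map_re_mul hc]
    exact h.gaussian

lemma IsCircularGaussian.memLp_im (h : IsCircularGaussian P X) :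
    MemLp (fun w => (X w).im) 4 P := by
  -- The imaginary part of `X` is the real part of `-iX`.
  have := (h.mul (c := -I) (by simp)).memLp_re
  simpa using this

lemma IsCircularGaussian.memLp (h : IsCircularGaussian P X) : MemLp X 4 P := by
  have h1 := h.memLp_re.ofReal (K := ℂ)
  have h2 := (h.memLp_im.ofReal (K := ℂ)).mul_const I
  refine (h1.add h2).ae_eq (.of_forall fun w => ?_)
  exact Complex.re_add_im (X w)

lemma memLp_two_mul {f g : Ω → ℂ} (hf : MemLp f 4 P) (hg : MemLp g 4 P) :
    MemLp (fun w => f w * g w) 2 P := by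
  have : ENNReal.HolderTriple 4 4 2 := ⟨by
    rw [← two_mul, show (4 : ENNReal) = 2 * 2 by norm_num,
      ENNReal.mul_inv (by simp) (by simp), ← mul_assoc, ENNReal.mul_inv_cancel (by simp) (by simp),
      one_mul]⟩
  exact hg.mul' hf

lemma integrable_mul_four {f₁ f₂ f₃ f₄ : Ω → ℂ} (h₁ : MemLp f₁ 4 P) (h₂ : MemLp f₂ 4 P)
    (h₃ : MemLp f₃ 4 P) (h₄ : MemLp f₄ 4 P) :
    Integrable (fun w => f₁ w * f₂ w * f₃ w * f₄ w) P := by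
  refine ((memLp_two_mul h₁ h₂).integrable_mul (memLp_two_mul h₃ h₄)).congr
    (.of_forall fun w => ?_)
  simp only [Pi.mul_apply, mul_assoc]

/-- The fourth absolute moment of a circular Gaussian variable. -/
lemma IsCircularGaussian.integral_four (h : IsCircularGaussian P X) :
    ∫ w, X w * X w * starRingEnd ℂ (X w) * starRingEnd ℂ (X w) ∂P
      = 2 * (∫ w, X w * starRingEnd ℂ (X w) ∂P) ^ 2 := by
  obtain ⟨v, hv⟩ := h.exists_gaussianReal
  have hm : AEMeasurable (fun w => (X w).re) P :=
    Complex.measurable_re.comp_aemeasurable h.aemeasurable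
  have i4 : ∀ (a b : Ω → ℝ), MemLp a 4 P → MemLp b 4 P → Integrable (fun w => a w ^ 2 * b w ^ 2) P :=
    fun a b ha hb => by
      have := (integrable_mul_four (ha.ofReal (K := ℂ)) (ha.ofReal (K := ℂ)) (hb.ofReal (K := ℂ))
        (hb.ofReal (K := ℂ))).re
      refine this.congr (.of_forall fun w => ?_)
      simp [← Complex.ofReal_mul]
      ring
  have hA := h.memLp_re
  have hB := h.memLp_im
  have iA4 : Integrable (fun w => (X w).re ^ 4) P :=
    (i4 _ _ hA hA).congr (.of_forall fun w => by ring)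
  have iB4 : Integrable (fun w => (X w).im ^ 4) P :=
    (i4 _ _ hB hB).congr (.of_forall fun w => by ring)
  have iAB := i4 _ _ hA hB
  have h24 : (2 : ENNReal) ≤ 4 := by norm_num
  have iA2 := (hA.mono_exponent h24).integrable_sq
  have iB2 := (hB.mono_exponent h24).integrable_sq
  have m4 : ∫ w, (X w).re ^ 4 ∂P = 3 * (v : ℝ) ^ 2 := by
    rw [← integral_pow_four_gaussianReal, ← hv, integral_map hm (by fun_prop)]
  have m2 : ∫ w, (X w).re ^ 2 ∂P = v := by
    have := variance_id_gaussianReal (μ := 0) (v := v)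
    rw [variance_eq_integral (by fun_prop)] at this
    simp only [id_eq, integral_id_gaussianReal, sub_zero] at this
    rw [← this, ← hv, integral_map hm (by fun_prop)]
  have b4 : ∫ w, (X w).im ^ 4 ∂P = 3 * (v : ℝ) ^ 2 := by
    rw [← m4, ← h.integral_re_mul_pow (c := -I) (by simp)]
    simp
  have b2 : ∫ w, (X w).im ^ 2 ∂P = v := by
    rw [← m2, ← h.integral_re_mul_pow (c := -I) (by simp)]
    simp
  -- The mixed moment of `A = Re X` and `B = Im X` comes from rotation invariance and the law of `A`
  -- alone. The rotations by `(3 ∓ 4i)/5` have real parts `(3A ± 4B)/5`; in the sum of their fourth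
  -- powers the odd terms cancel, and both have the fourth moment of `A`. Solving gives `E A²B² =
  -- v²`.
  have n1 : ‖(3 / 5 - 4 / 5 * I : ℂ)‖ = 1 := by
    rw [Complex.norm_def, Complex.normSq_apply]; norm_num
  have n2 : ‖(3 / 5 + 4 / 5 * I : ℂ)‖ = 1 := by
    rw [Complex.norm_def, Complex.normSq_apply]; norm_num
  have r1 := h.integral_re_mul_pow n1 4
  have r2 := h.integral_re_mul_pow n2 4
  have hsum : ∫ w, ((3 / 5 - 4 / 5 * I) * X w).re ^ 4 ∂P + ∫ w, ((3 / 5 + 4 / 5 * I) * X w).re ^ 4 ∂P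
      = 2 / 625 * (81 * ∫ w, (X w).re ^ 4 ∂P + 864 * ∫ w, (X w).re ^ 2 * (X w).im ^ 2 ∂P
        + 256 * ∫ w, (X w).im ^ 4 ∂P) := by
    have hmem : ∀ c : ℂ, ‖c‖ = 1 → Integrable (fun w => (c * X w).re ^ 4) P := fun c hc =>
      (i4 _ _ (h.mul hc).memLp_re (h.mul hc).memLp_re).congr (.of_forall fun w => by ring)
    have iS : Integrable (fun w => 81 * (X w).re ^ 4 + 864 * ((X w).re ^ 2 * (X w).im ^ 2)) P :=
      (iA4.const_mul _).add (iAB.const_mul _)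
    rw [← integral_add (hmem _ n1) (hmem _ n2), ← integral_const_mul, ← integral_const_mul,
      ← integral_const_mul, ← integral_add (iA4.const_mul _) (iAB.const_mul _),
      ← integral_add iS (iB4.const_mul _), ← integral_const_mul]
    refine integral_congr_ae (.of_forall fun w => ?_)
    simp
    ring
  have hq : ∫ w, (X w).re ^ 2 * (X w).im ^ 2 ∂P = (v : ℝ) ^ 2 := by
    rw [r1, r2, m4, b4] at hsum
    linarith
  -- With `|X|² = A² + B²`, the fourth moment is `3v² + 2v² + 3v² = 8v²`, and `E|X|² = 2v`.
  have e1 : ∫ w, X w * X w * starRingEnd ℂ (X w) * starRingEnd ℂ (X w) ∂P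
      = ((∫ w, ((X w).re ^ 4 + 2 * ((X w).re ^ 2 * (X w).im ^ 2) + (X w).im ^ 4) ∂P : ℝ) : ℂ) := by
    rw [← integral_complex_ofReal]
    refine integral_congr_ae (.of_forall fun w => ?_)
    change X w * X w * starRingEnd ℂ (X w) * starRingEnd ℂ (X w) = _
    rw [show X w * X w * starRingEnd ℂ (X w) * starRingEnd ℂ (X w)
      = (X w * starRingEnd ℂ (X w)) ^ 2 by ring, Complex.mul_conj, Complex.normSq_apply]
    push_cast
    ring
  have e2 : ∫ w, X w * starRingEnd ℂ (X w) ∂P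
      = ((∫ w, ((X w).re ^ 2 + (X w).im ^ 2) ∂P : ℝ) : ℂ) := by
    rw [← integral_complex_ofReal]
    refine integral_congr_ae (.of_forall fun w => ?_)
    simp only [Complex.mul_conj, Complex.normSq_apply]
    push_cast
    ring
  have iS : Integrable (fun w => (X w).re ^ 4 + 2 * ((X w).re ^ 2 * (X w).im ^ 2)) P :=
    iA4.add (iAB.const_mul _)
  rw [e1, e2, integral_add iS iB4, integral_add iA4 (iAB.const_mul _),
    integral_const_mul, integral_add iA2 iB2, m4, b4, hq, m2, b2]
  push_cast
  ring

end FourthMoment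

/-! ### Polarization of a form of degree (2, 2) -/

section Polarization

variable {M : Type*} [AddCommGroup M] [Module ℂ M]

/-- Polarization: a form, antilinear and symmetric in its first two and linear and symmetric in
its last two arguments, vanishes if it vanishes on the diagonal. -/
lemma eq_zero_of_diag {R : M → M → M → M → ℂ}
    (a₁ : ∀ a a' b c d, R (a + a') b c d = R a b c d + R a' b c d)
    (m₁ : ∀ (z : ℂ) a b c d, R (z • a) b c d = starRingEnd ℂ z * R a b c d)
    (a₃ : ∀ a b c c' d, R a b (c + c') d = R a b c d + R a b c' d)
    (m₃ : ∀ (z : ℂ) a b c d, R a b (z • c) d = z * R a b c d)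
    (s₁ : ∀ a b c d, R a b c d = R b a c d) (s₃ : ∀ a b c d, R a b c d = R a b d c)
    (h : ∀ a, R a a a a = 0) (a b c d : M) : R a b c d = 0 := by
  have a₂ : ∀ a b b' c d, R a (b + b') c d = R a b c d + R a b' c d := fun a b b' c d => by
    rw [s₁, a₁, s₁ b, s₁ b']
  have m₂ : ∀ (z : ℂ) a b c d, R a (z • b) c d = starRingEnd ℂ z * R a b c d :=
    fun z a b c d => by rw [s₁, m₁, s₁ b]
  have a₄ : ∀ a b c d d', R a b c (d + d') = R a b c d + R a b c d' := fun a b c d d' => by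
    rw [s₃, a₃, s₃ _ _ d, s₃ _ _ d']
  have m₄ : ∀ (z : ℂ) a b c d, R a b c (z • d) = z * R a b c d :=
    fun z a b c d => by rw [s₃, m₃, s₃ _ _ d]
  have key : ∀ a b, R a a b b = 0 := fun a b => by
    -- Expansion of the diagonal value at `a + z b`. Averaging over `z` and `-z` keeps only the
    -- `z²`, `z̄²` and `z z̄` terms, and `z = 1, i, 1 + i` separate these three.
    have f : ∀ z : ℂ, z ^ 2 * R a a b b + starRingEnd ℂ z ^ 2 * R b b a a
        + 2 * z * R a a a b + 2 * starRingEnd ℂ z * R a b a a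
        + 4 * z * starRingEnd ℂ z * R a b a b + 2 * z * starRingEnd ℂ z ^ 2 * R b b a b
        + 2 * z ^ 2 * starRingEnd ℂ z * R a b b b = 0 := fun z => by
      have h1 := h (a + z • b)
      simp only [a₁, a₂, a₃, a₄, m₁, m₂, m₃, m₄, h, s₁ b a, s₃ _ _ b a] at h1
      linear_combination h1
    have f1 := f 1
    have f2 := f (-1)
    have f3 := f Complex.I
    have f4 := f (-Complex.I)
    have f5 := f (1 + Complex.I)
    have f6 := f (-(1 + Complex.I))
    simp only [map_neg, map_add, map_one, Complex.conj_I] at f1 f2 f3 f4 f5 f6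
    have g1 : R a a b b + R b b a a + 4 * R a b a b = 0 := by linear_combination (f1 + f2) / 2
    have g2 : -R a a b b - R b b a a + 4 * R a b a b = 0 := by
      linear_combination (f3 + f4) / 2 - (R a a b b + R b b a a - 4 * R a b a b) * Complex.I_sq
    have g3 : 2 * Complex.I * (R a a b b - R b b a a) + 8 * R a b a b = 0 := by
      linear_combination (f5 + f6) / 2 - (R a a b b + R b b a a - 4 * R a b a b) * Complex.I_sq
    have g4 : R a b a b = 0 := by linear_combination (g1 + g2) / 8
    rw [g4] at g1 g3
    have g5 : R a a b b - R b b a a = 0 := by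
      have : 2 * Complex.I * (R a a b b - R b b a a) = 0 := by linear_combination g3
      simpa using this
    linear_combination (g1 + g5) / 2
  -- Ordinary polarization of a symmetric bilinear form, here in the first pair of arguments and
  -- then in the last.
  have key2 : ∀ a a' b, R a a' b b = 0 := fun a a' b => by
    have h1 := key (a + a') b
    simp only [a₁, a₂, key, s₁ a' a] at h1
    linear_combination h1 / 2
  have h1 := key2 a b (c + d)
  simp only [a₃, a₄, key2, s₃ _ _ d c] at h1
  linear_combination h1 / 2

end Polarization

/-! ### Wick's formula -/

section Wick

variable {Ω : Type*} [MeasurableSpace Ω] {P : Measure Ω} [IsProbabilityMeasure P]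
  {V : Type} [NormedAddCommGroup V] [InnerProductSpace ℝ V]

lemma isCircularGaussian_apply {u : GSP P V} (hsymm : IsSymmetricGSP u) (hgauss : IsGaussianGSP u)
    (φ : 𝓢(V, ℂ)) : IsCircularGaussian P (fun w => u φ w) where
  aemeasurable := (Lp.aestronglyMeasurable (u φ)).aemeasurable
  rotate c hc := by
    have hm : AEMeasurable (fun w => u φ w) P := (Lp.aestronglyMeasurable (u φ)).aemeasurable
    have h := congrArg (Measure.map fun x : Fin 1 → ℂ => x 0) (hsymm c hc 1 fun _ => φ)
    rwa [AEMeasurable.map_map_of_aemeasurable (measurable_pi_apply 0).aemeasurable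
      (aemeasurable_pi_lambda _ fun _ => hm.const_mul c),
      AEMeasurable.map_map_of_aemeasurable (measurable_pi_apply 0).aemeasurable
      (aemeasurable_pi_lambda _ fun _ => hm)] at h
  gaussian := by
    have hm : AEMeasurable (fun w => u φ w) P := (Lp.aestronglyMeasurable (u φ)).aemeasurable
    have h := hgauss 1 fun _ => φ
    have h2 := ProbabilityTheory.isGaussian_map (μ := P.map fun w =>
      (Sum.elim (fun _ => (u φ w).re) (fun _ => (u φ w).im) : Fin 1 ⊕ Fin 1 → ℝ))
      (ContinuousLinearMap.proj (R := ℝ) (φ := fun _ : Fin 1 ⊕ Fin 1 => ℝ) (Sum.inl 0))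
    rwa [AEMeasurable.map_map_of_aemeasurable (by fun_prop)] at h2
    refine aemeasurable_pi_lambda _ fun i => ?_
    cases i
    · exact Complex.measurable_re.comp_aemeasurable hm
    · exact Complex.measurable_im.comp_aemeasurable hm

lemma gsp_add_ae (u : GSP P V) (φ ψ : 𝓢(V, ℂ)) :
    ∀ᵐ w ∂P, u (φ + ψ) w = u φ w + u ψ w := by
  rw [map_add]
  exact Lp.coeFn_add _ _

lemma gsp_smul_ae (u : GSP P V) (c : ℂ) (φ : 𝓢(V, ℂ)) :
    ∀ᵐ w ∂P, u (c • φ) w = starRingEnd ℂ c * u φ w := by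
  rw [map_smulₛₗ]
  exact Lp.coeFn_smul _ _

/-- Wick's formula for symmetric Gaussian processes. -/
lemma integral_four {u : GSP P V} (hsymm : IsSymmetricGSP u) (hgauss : IsGaussianGSP u)
    (a b c d : 𝓢(V, ℂ)) :
    ∫ w, u a w * u b w * starRingEnd ℂ (u c w) * starRingEnd ℂ (u d w) ∂P
      = covOp u c a * covOp u d b + covOp u d a * covOp u c b := by
  have h4 : ∀ a, MemLp (fun w => u a w) 4 P := fun a =>
    (isCircularGaussian_apply hsymm hgauss a).memLp
  have h4' : ∀ a, MemLp (fun w => starRingEnd ℂ (u a w)) 4 P := fun a => (h4 a).star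
  have hi : ∀ a b c d, Integrable (fun w => u a w * u b w * starRingEnd ℂ (u c w)
      * starRingEnd ℂ (u d w)) P := fun a b c d =>
    integrable_mul_four (h4 a) (h4 b) (h4' c) (h4' d)
  -- The defect in Wick's formula. On the diagonal it is the defect in `E|X|⁴ = 2 (E|X|²)²`, so
  -- polarization finishes; the first two slots are antilinear because processes are.
  set R : 𝓢(V, ℂ) → 𝓢(V, ℂ) → 𝓢(V, ℂ) → 𝓢(V, ℂ) → ℂ := fun a b c d =>
    ∫ w, u a w * u b w * starRingEnd ℂ (u c w) * starRingEnd ℂ (u d w) ∂P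
      - (covOp u c a * covOp u d b + covOp u d a * covOp u c b) with hR
  suffices h : R a b c d = 0 from sub_eq_zero.1 h
  refine eq_zero_of_diag (R := R) ?_ ?_ ?_ ?_ ?_ ?_ ?_ a b c d
  · intro a a' b c d
    have : ∫ w, u (a + a') w * u b w * starRingEnd ℂ (u c w) * starRingEnd ℂ (u d w) ∂P
        = ∫ w, u a w * u b w * starRingEnd ℂ (u c w) * starRingEnd ℂ (u d w) ∂P
        + ∫ w, u a' w * u b w * starRingEnd ℂ (u c w) * starRingEnd ℂ (u d w) ∂P := by
      rw [← integral_add (hi _ _ _ _) (hi _ _ _ _)]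
      refine integral_congr_ae ?_
      filter_upwards [gsp_add_ae u a a'] with w hw
      rw [hw]; ring
    simp only [hR]
    rw [this, map_add, map_add]
    ring
  · intro z a b c d
    have : ∫ w, u (z • a) w * u b w * starRingEnd ℂ (u c w) * starRingEnd ℂ (u d w) ∂P
        = starRingEnd ℂ z *
          ∫ w, u a w * u b w * starRingEnd ℂ (u c w) * starRingEnd ℂ (u d w) ∂P := by
      rw [← integral_const_mul]
      refine integral_congr_ae ?_
      filter_upwards [gsp_smul_ae u z a] with w hw
      rw [hw]; ring
    simp only [hR]
    rw [this, map_smulₛₗ, map_smulₛₗ, smul_eq_mul, smul_eq_mul]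
    ring
  · intro a b c c' d
    have : ∫ w, u a w * u b w * starRingEnd ℂ (u (c + c') w) * starRingEnd ℂ (u d w) ∂P
        = ∫ w, u a w * u b w * starRingEnd ℂ (u c w) * starRingEnd ℂ (u d w) ∂P
        + ∫ w, u a w * u b w * starRingEnd ℂ (u c' w) * starRingEnd ℂ (u d w) ∂P := by
      rw [← integral_add (hi _ _ _ _) (hi _ _ _ _)]
      refine integral_congr_ae ?_
      filter_upwards [gsp_add_ae u c c'] with w hw
      rw [hw, map_add]; ring
    simp only [hR]
    rw [this, map_add, add_apply, add_apply]
    ring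
  · intro z a b c d
    have : ∫ w, u a w * u b w * starRingEnd ℂ (u (z • c) w) * starRingEnd ℂ (u d w) ∂P
        = z * ∫ w, u a w * u b w * starRingEnd ℂ (u c w) * starRingEnd ℂ (u d w) ∂P := by
      rw [← integral_const_mul]
      refine integral_congr_ae ?_
      filter_upwards [gsp_smul_ae u z c] with w hw
      rw [hw, map_mul, Complex.conj_conj]; ring
    simp only [hR]
    rw [this, map_smul, smul_apply, smul_apply, smul_eq_mul, smul_eq_mul]
    ring
  · intro a b c d
    have : ∫ w, u a w * u b w * starRingEnd ℂ (u c w) * starRingEnd ℂ (u d w) ∂P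
        = ∫ w, u b w * u a w * starRingEnd ℂ (u c w) * starRingEnd ℂ (u d w) ∂P :=
      integral_congr_ae (.of_forall fun w => by ring)
    simp only [hR, this]
    ring
  · intro a b c d
    have : ∫ w, u a w * u b w * starRingEnd ℂ (u c w) * starRingEnd ℂ (u d w) ∂P
        = ∫ w, u a w * u b w * starRingEnd ℂ (u d w) * starRingEnd ℂ (u c w) ∂P :=
      integral_congr_ae (.of_forall fun w => by ring)
    simp only [hR, this]
    ring
  · intro a
    have := (isCircularGaussian_apply hsymm hgauss a).integral_four
    simp only [hR, this, covOp_apply]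
    ring

end Wick

/-! ### The covariance of `u` in terms of its spectral measure -/

section Covariance

variable {V : Type} [NormedAddCommGroup V] [InnerProductSpace ℝ V] [FiniteDimensional ℝ V]
  [MeasurableSpace V] [BorelSpace V]

lemma fourierConst_pos : ∃ c : ℝ, 0 < c ∧ fourierConst V = c :=
  ⟨_, Real.rpow_pos_of_pos (by positivity) _, rfl⟩

lemma fourierS_eq (f : 𝓢(V, ℂ)) (ξ : V) :
    fourierS f ξ = fourierConst V * 𝓕 f ((2 * Real.pi)⁻¹ • ξ) := rfl

lemma fourierS_convS (f g : 𝓢(V, ℂ)) (ξ : V) :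
    fourierS (convS f g) ξ = (fourierConst V)⁻¹ * (fourierS f ξ * fourierS g ξ) := by
  have h : 𝓕 (convS f g) ((2 * Real.pi)⁻¹ • ξ)
      = 𝓕 f ((2 * Real.pi)⁻¹ • ξ) * 𝓕 g ((2 * Real.pi)⁻¹ • ξ) := by
    rw [convS, SchwartzMap.fourier_convolution_apply]
    exact Real.fourier_mul_convolution_eq f.integrable g.integrable _
  rw [fourierS_eq, fourierS_eq, fourierS_eq, h]
  field_simp [fourierConst_ne_zero (V := V)]

lemma fourierS_starS (f : 𝓢(V, ℂ)) (ξ : V) :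
    fourierS (starS f) ξ = starRingEnd ℂ (fourierS f ξ) := by
  obtain ⟨c, -, hc⟩ := fourierConst_pos (V := V)
  rw [fourierS_apply, fourierS_apply, map_mul, ← integral_conj, hc, Complex.conj_ofReal]
  congr 1
  rw [← integral_neg_eq_self]
  refine integral_congr_ae (.of_forall fun x => ?_)
  simp [starS_apply, ← Complex.exp_conj]

/-- `(2π)⁻ⁿ = c²` for the constant `c` of the Fourier transform. -/
lemma fourierConst_sq : fourierConst V ^ 2 = (((2 * Real.pi) ^ Module.finrank ℝ V)⁻¹ : ℝ) := by
  rw [fourierConst, ← Complex.ofReal_pow, ← Real.rpow_natCast, ← Real.rpow_mul (by positivity),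
    ← Real.rpow_natCast, ← Real.rpow_neg (by positivity)]
  congr 2
  push_cast
  ring

/-- Fourier inversion in the normalization of `chi`. -/
lemma integral_chi_integral_chi {f : V → ℂ} (hc : Continuous f) (hf : Integrable f)
    (hf' : Integrable fun η => ∫ y, chi y η * f y) (x : V) :
    fourierConst V ^ 2 * ∫ η, chi η (-x) * ∫ y, chi y η * f y = f x := by
  have hchi : ∀ y w : V, (𝐞 (-⟪y, w⟫_ℝ) : ℂ) = chi y ((2 * Real.pi) • w) := fun y w => by
    rw [Real.fourierChar_apply, chi, real_inner_smul_right]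
    congr 1
    push_cast
    ring
  have hF : ∀ w, 𝓕 f w = ∫ y, chi y ((2 * Real.pi) • w) * f y := fun w => by
    rw [Real.fourier_eq]
    simp only [Circle.smul_def, hchi, smul_eq_mul]
  have hi : Integrable (𝓕 f) := by
    have := hf'.comp_smul (R := 2 * Real.pi) (by positivity)
    exact this.congr (.of_forall fun w => (hF w).symm)
  have h := congrFun (hc.fourierInv_fourier_eq hf hi) x
  rw [← h, Real.fourierInv_eq]
  have h2 : ∫ v, 𝐞 ⟪v, x⟫_ℝ • 𝓕 f v
      = ∫ v : V, (fun η => chi η (-x) * ∫ y, chi y η * f y) ((2 * Real.pi) • v) := by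
    refine integral_congr_ae (.of_forall fun v => ?_)
    simp only [hF, Circle.smul_def, smul_eq_mul]
    congr 1
    rw [Real.fourierChar_apply, chi, real_inner_smul_left, inner_neg_right]
    congr 1
    push_cast
    ring
  -- The substitution `η = 2π v` passes between the two normalizations; its Jacobian `(2π)⁻ⁿ` is the
  -- square of the Fourier constant.
  have h3 := Measure.integral_comp_smul (volume : Measure V)
    (fun η => chi η (-x) * ∫ y, chi y η * f y) (2 * Real.pi)
  rw [h2, h3, fourierConst_sq, abs_of_pos (by positivity)]
  exact (Complex.coe_smul _ _).symm

lemma fourierS_fourierS (f : 𝓢(V, ℂ)) (x : V) : fourierS (fourierS f) x = f (-x) := by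
  have h0 : ∀ g : 𝓢(V, ℂ), ∀ η, ∫ y, chi y η * g y = (fourierConst V)⁻¹ * fourierS g η := fun g η => by
    rw [fourierS_apply, inv_mul_cancel_left₀ fourierConst_ne_zero]
    refine integral_congr_ae (.of_forall fun y => ?_)
    change chi y η * g y = _
    rw [mul_comm, chi]
    congr 2
    push_cast
    ring
  have h1 := integral_chi_integral_chi f.continuous f.integrable (by
    simp_rw [h0]
    exact (fourierS f).integrable.const_mul _) (-x)
  simp only [h0, neg_neg] at h1
  rw [← h1]
  have h2 : ∀ η, chi η x * ((fourierConst V)⁻¹ * fourierS f η)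
      = (fourierConst V)⁻¹ * (chi η x * fourierS f η) := fun η => by ring
  simp_rw [h2]
  rw [integral_const_mul, h0]
  field_simp [fourierConst_ne_zero (V := V)]

variable {Ω : Type*} [MeasurableSpace Ω] {P : Measure Ω}

/-- The convolution theorem turns `φ * ψ*` into the product of `φ̂` and the conjugate of `ψ̂`, and
its constant cancels the one in the definition of the spectral measure. -/
lemma covOp_fourierGSP {v : GSP P V} {μ : Measure V} [μ.HasTemperateGrowth]
    (h : IsSpectralMeasure v μ) (φ ψ : 𝓢(V, ℂ)) :
    covOp v ψ φ = ∫ x, starRingEnd ℂ (fourierS φ x) * fourierS ψ x ∂μ := by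
  obtain ⟨k, hk, hμ⟩ := h
  obtain ⟨c, -, hc⟩ := fourierConst_pos (V := V)
  have h1 : ∀ f, k f = fourierConst V * ∫ x, starRingEnd ℂ (fourierS f x) ∂μ := fun f => by
    rw [← measureD_apply, hμ, smul_apply, fourierD_apply, smul_eq_mul,
      mul_inv_cancel_left₀ fourierConst_ne_zero]
  rw [hk, h1, ← integral_const_mul]
  refine integral_congr_ae (.of_forall fun x => ?_)
  simp only [fourierS_convS, fourierS_starS, map_mul, Complex.conj_conj, map_inv₀]
  rw [hc, Complex.conj_ofReal, ← hc, mul_inv_cancel_left₀ fourierConst_ne_zero]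

lemma integral_reflectM (ν : Measure V) (F : V → ℂ) :
    ∫ x, F x ∂(reflectM ν) = ∫ x, F (-x) ∂ν :=
  (MeasurableEquiv.neg V).measurableEmbedding.integral_map F

/-- In the formula for `û` the test functions are themselves Fourier transforms. A second transform
is the reflection, which moves onto the measure. -/
lemma covOp_eq_integral {u : GSP P V} {μ : Measure V} [μ.HasTemperateGrowth]
    (h : IsSpectralMeasure (fourierGSP u) μ) (φ ψ : 𝓢(V, ℂ)) :
    covOp u ψ φ = ∫ x, starRingEnd ℂ (φ x) * ψ x ∂(reflectM μ) := by
  have h1 : covOp u ψ φ = covOp (fourierGSP u) (fourierS ψ) (fourierS φ) := by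
    change inner ℂ (u ψ) (u φ)
      = inner ℂ (fourierGSP u (fourierS ψ)) (fourierGSP u (fourierS φ))
    rw [fourierGSP_apply, fourierGSP_apply]
  rw [h1, covOp_fourierGSP h, integral_reflectM]
  simp only [fourierS_fourierS]

end Covariance

/-! ### Extension by continuity from a dense range -/

section Extension

/-- A semilinear map dominated by a continuous function of the values of a linear map with dense
range factors continuously through it. -/
lemma exists_extension {F S L : Type*} [AddCommGroup F] [Module ℂ F] [AddCommGroup S] [Module ℂ S]
    [UniformSpace S] [IsUniformAddGroup S] [ContinuousSMul ℂ S] [NormedAddCommGroup L]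
    [NormedSpace ℂ L] [CompleteSpace L] (e : F →ₗ[ℂ] S) (N : F →ₗ⋆[ℂ] L) (he : DenseRange e)
    {q : S → ℝ} (hq : Continuous q) (hq0 : q 0 = 0) (h : ∀ x, ‖N x‖ ≤ q (e x)) :
    ∃ U : S →L⋆[ℂ] L, ∀ x, U (e x) = N x := by
  -- The bound makes `N` vanish wherever `e` does, so `N` descends to the range of `e`; there the
  -- same bound gives continuity at `0`.
  have hker : LinearMap.ker e ≤ LinearMap.ker N := fun x hx => by
    have := h x
    rw [LinearMap.mem_ker.1 hx, hq0] at this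
    exact norm_le_zero_iff.1 this
  let f : LinearMap.range e →ₗ⋆[ℂ] L :=
    ((LinearMap.ker e).liftQ N hker).comp e.quotKerEquivRange.symm.toLinearMap
  have hf : ∀ x, f ⟨e x, x, rfl⟩ = N x := fun x => by
    have h1 : e.quotKerEquivRange.symm ⟨e x, x, rfl⟩ = (LinearMap.ker e).mkQ x := by
      rw [LinearEquiv.symm_apply_eq]
      rfl
    change (LinearMap.ker e).liftQ N hker (e.quotKerEquivRange.symm ⟨e x, x, rfl⟩) = _
    rw [h1]
    rfl
  have hfc : Continuous f := by
    refine continuous_of_continuousAt_zero f ?_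
    rw [ContinuousAt, map_zero, tendsto_zero_iff_norm_tendsto_zero]
    have h1 : Filter.Tendsto (fun a : LinearMap.range e => q a) (nhds 0) (nhds 0) := by
      have := (hq.comp continuous_subtype_val).tendsto (0 : LinearMap.range e)
      simpa [hq0, Function.comp_def] using this
    refine squeeze_zero (fun _ => norm_nonneg _) ?_ h1
    rintro ⟨_, x, rfl⟩
    rw [hf]
    exact h x
  let g : LinearMap.range e →L⋆[ℂ] L := ⟨f, hfc⟩
  have hd : DenseRange (LinearMap.range e).subtypeL := by
    have h1 : Set.range (LinearMap.range e).subtypeL = Set.range e := Subtype.range_coe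
    rw [DenseRange, h1]
    exact he
  have : IsUniformAddGroup (LinearMap.range e) :=
    (LinearMap.range e).toAddSubgroup.isUniformAddGroup
  refine ⟨g.extend (LinearMap.range e).subtypeL, fun x => ?_⟩
  have := g.extend_eq hd isUniformEmbedding_subtype_val.isUniformInducing ⟨e x, x, rfl⟩
  exact this.trans (hf x)

end Extension

/-! ### Existence, uniqueness and moments of `u ⊗ ū` -/

section TensorSquare

variable {V : Type} [NormedAddCommGroup V] [InnerProductSpace ℝ V] [FiniteDimensional ℝ V]
  [MeasurableSpace V] [BorelSpace V]

/-- Restriction of a Schwartz function to the diagonal. -/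
def diagS (V : Type) [NormedAddCommGroup V] [InnerProductSpace ℝ V] :
    𝓢(Phase V, ℂ) →L[ℂ] 𝓢(V, ℂ) :=
  compCLMOfAntilipschitz ℂ (K := 1) (g := ((WithLp.prodContinuousLinearEquiv 2 ℝ V V).symm :
      V × V →L[ℝ] Phase V).comp ((ContinuousLinearMap.id ℝ V).prod (ContinuousLinearMap.id ℝ V)))
    (ContinuousLinearMap.hasTemperateGrowth _)
    (AddMonoidHomClass.antilipschitz_of_bound _ fun x => by
      rw [NNReal.coe_one, one_mul]
      exact WithLp.norm_fst_le (x := pt x x))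

lemma diagS_apply (Φ : 𝓢(Phase V, ℂ)) (x : V) : diagS V Φ x = Φ (pt x x) := rfl

lemma ext_of_tensorConj {L : Type*} [AddCommGroup L] [Module ℂ L] [TopologicalSpace L] [T2Space L]
    {S T : 𝓢(Phase V, ℂ) →L⋆[ℂ] L}
    (h : ∀ f g, S (tensorConj f g) = T (tensorConj f g)) : S = T :=
  ContinuousLinearMap.ext_on dense_span_tensorConj (by rintro _ ⟨p, rfl⟩; exact h p.1 p.2)

lemma integral_tensorM (ν ρ : Measure V) (F : Phase V → ℂ) :
    ∫ p, F p ∂(tensorM ν ρ) = ∫ p : V × V, F (pt p.1 p.2) ∂(ν.prod ρ) :=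
  (MeasurableEquiv.toLp 2 (V × V)).measurableEmbedding.integral_map F

/-- The inner product of `L²(ν)` for Schwartz functions. -/
def pairS (ν : Measure V) (φ ψ : 𝓢(V, ℂ)) : ℂ := ∫ x, starRingEnd ℂ (φ x) * ψ x ∂ν

lemma pairS_eq_inner (ν : Measure V) [ν.HasTemperateGrowth] (φ ψ : 𝓢(V, ℂ)) :
    pairS ν φ ψ = inner ℂ (toLpCLM ℂ ℂ 2 ν φ) (toLpCLM ℂ ℂ 2 ν ψ) := by
  refine Eq.trans ?_ (inner_toL2_toL2_eq φ ψ ν).symm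
  exact integral_congr_ae (.of_forall fun x => mul_comm _ _)

lemma pairS_tensorConj (ν : Measure V) [ν.HasTemperateGrowth] (a b c d : 𝓢(V, ℂ)) :
    pairS (tensorM ν ν) (tensorConj a b) (tensorConj c d) = pairS ν a c * pairS ν d b := by
  have := sigmaFinite_of_hasTemperateGrowth ν
  rw [pairS, integral_tensorM, pairS, pairS, ← integral_prod_mul]
  refine integral_congr_ae (.of_forall fun p => ?_)
  simp only [tensorConj_apply, map_mul, Complex.conj_conj]
  ring

variable {Ω : Type*} [MeasurableSpace Ω] {P : Measure Ω} [IsProbabilityMeasure P]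

lemma isTensorSquare_unique {u : GSP P V} {U U' : GSP P (Phase V)} (h : IsTensorSquare u U)
    (h' : IsTensorSquare u U') : U' = U :=
  ext_of_tensorConj fun f g => Lp.ext (by
    filter_upwards [h f g, h' f g] with w h1 h2
    rw [h1, h2])

/-- Centering removes the component along the constant function `1`, a unit vector of `L²(P)` since
`P` is a probability measure. -/
lemma covOp_centered {W : Type} [NormedAddCommGroup W] [InnerProductSpace ℝ W] (U : GSP P W)
    (φ ψ : 𝓢(W, ℂ)) : covOp (centered U) ψ φ
      = covOp U ψ φ - meanD U φ * starRingEnd ℂ (meanD U ψ) := by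
  set e : Lp ℂ 2 P := Lp.const 2 P (1 : ℂ)
  have h1 : ∀ φ, inner ℂ e (U φ) = meanD U φ := fun φ => rfl
  have h2 : ∀ φ, inner ℂ (U φ) e = starRingEnd ℂ (meanD U φ) := fun φ => by
    rw [← h1, inner_conj_symm]
  have h3 : inner ℂ e e = (1 : ℂ) := by
    rw [L2.inner_def]
    have : ∀ᵐ w ∂P, inner ℂ (e w) (e w) = (1 : ℂ) := by
      filter_upwards [Lp.coeFn_const 2 P (1 : ℂ)] with w hw
      rw [hw]; simp
    rw [integral_congr_ae this]
    simp
  change inner ℂ (U ψ - meanD U ψ • e) (U φ - meanD U φ • e) = inner ℂ (U ψ) (U φ) - _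
  rw [inner_sub_left, inner_sub_right, inner_sub_right, inner_smul_left, inner_smul_left,
    inner_smul_right, inner_smul_right, h1, h2, h3]
  ring

/-- If the covariance of a symmetric Gaussian process is that of `L²(ν)`, then `u ⊗ ū` exists,
its mean is the restriction of `ν` to the diagonal and the covariance of the centered process is
that of `L²(ν ⊗ ν)`. -/
lemma exists_isTensorSquare {u : GSP P V} (hsymm : IsSymmetricGSP u) (hgauss : IsGaussianGSP u)
    (ν : Measure V) [ν.HasTemperateGrowth] (hν : ∀ φ ψ, covOp u ψ φ = pairS ν φ ψ) :
    ∃ U : GSP P (Phase V), IsTensorSquare u U ∧ meanD U = (measureD ν).comp (diagS V) ∧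
      ∀ Φ Ψ, covOp (centered U) Ψ Φ = pairS (tensorM ν ν) Φ Ψ := by
  have h4 : ∀ a, MemLp (fun w => u a w) 4 P := fun a =>
    (isCircularGaussian_apply hsymm hgauss a).memLp
  have h4' : ∀ a, MemLp (fun w => starRingEnd ℂ (u a w)) 4 P := fun a => (h4 a).star
  have hm : ∀ p : 𝓢(V, ℂ) × 𝓢(V, ℂ),
      MemLp (fun w => u p.1 w * starRingEnd ℂ (u p.2 w)) 2 P := fun p =>
    memLp_two_mul (h4 p.1) (h4' p.2)
  set X : 𝓢(V, ℂ) × 𝓢(V, ℂ) → Lp ℂ 2 P := fun p => (hm p).toLp _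
  set D : TempDist (Phase V) := (measureD ν).comp (diagS V)
  have hD : ∀ a b, D (tensorConj a b) = pairS ν a b := fun a b => by
    change measureD ν (diagS V (tensorConj a b)) = _
    rw [measureD_apply]
    refine integral_congr_ae (.of_forall fun x => ?_)
    simp only [diagS_apply, tensorConj_apply, map_mul, Complex.conj_conj]
  set J := toLpCLM (E := Phase V) ℂ ℂ 2 (tensorM ν ν)
  -- The second moment form that `U` must have: product of the means plus covariance in `L²(ν ⊗ ν)`.
  set H : 𝓢(Phase V, ℂ) → 𝓢(Phase V, ℂ) → ℂ := fun Φ Ψ =>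
    D Φ * starRingEnd ℂ (D Ψ) + inner ℂ (J Φ) (J Ψ)
  have hX : ∀ p q, inner ℂ (X q) (X p) = H (tensorConj p.1 p.2) (tensorConj q.1 q.2) := by
    intro p q
    have h1 : inner ℂ (X q) (X p)
        = ∫ w, u p.1 w * u q.2 w * starRingEnd ℂ (u p.2 w) * starRingEnd ℂ (u q.1 w) ∂P := by
      rw [L2.inner_def]
      refine integral_congr_ae ?_
      filter_upwards [(hm p).coeFn_toLp, (hm q).coeFn_toLp] with w h1 h2
      rw [h1, h2]
      simp
      ring
    -- The pairing within `p` and within `q` yields the product of means; the pairing across yields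
    -- the inner product of the tensors.
    rw [h1, integral_four hsymm hgauss]
    simp only [H, hD, hν]
    rw [← pairS_eq_inner, pairS_tensorConj]
    congr 2
    rw [pairS, pairS, ← integral_conj]
    refine integral_congr_ae (.of_forall fun x => ?_)
    simp [mul_comm]
  -- Formal combinations of pairs postpone the question of whether the values on combinations of
  -- tensors are well defined; the norm identity answers it.
  let e : ((𝓢(V, ℂ) × 𝓢(V, ℂ)) →₀ ℂ) →ₗ[ℂ] 𝓢(Phase V, ℂ) :=
    Finsupp.linearCombination ℂ fun p => tensorConj p.1 p.2
  let N : ((𝓢(V, ℂ) × 𝓢(V, ℂ)) →₀ ℂ) →ₗ⋆[ℂ] Lp ℂ 2 P :=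
    { toFun := fun x => x.sum fun p c => starRingEnd ℂ c • X p
      map_add' := fun x y => Finsupp.sum_add_index' (by simp) (by simp [add_smul])
      map_smul' := fun c x => by
        rw [Finsupp.sum_smul_index' (by simp), Finsupp.smul_sum]
        simp [mul_smul] }
  have he1 : ∀ p c, e (Finsupp.single p c) = c • tensorConj p.1 p.2 := fun p c =>
    Finsupp.linearCombination_single ℂ c p
  have hN1 : ∀ p c, N (Finsupp.single p c) = starRingEnd ℂ c • X p := fun p c =>
    Finsupp.sum_single_index (h := fun p c => starRingEnd ℂ c • X p) (by simp)
  have hNe : ∀ x y, inner ℂ (N y) (N x) = H (e x) (e y) := by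
    intro x y
    induction x using Finsupp.induction_linear with
    | zero => simp [H]
    | add x x' hx hx' =>
      rw [map_add, inner_add_right, hx, hx', map_add]
      simp only [H, map_add, inner_add_left]
      ring
    | single p c =>
      induction y using Finsupp.induction_linear with
      | zero => simp [H]
      | add y y' hy hy' =>
        rw [map_add, inner_add_left, hy, hy', map_add e y]
        simp only [H, map_add, inner_add_right]
        ring
      | single q c' =>
        rw [hN1, hN1, inner_smul_left, inner_smul_right, hX, he1, he1]
        simp only [H, map_smul, map_smulₛₗ, inner_smul_left, inner_smul_right, smul_eq_mul,
          map_mul, Complex.conj_conj]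
        ring
  have hdense : DenseRange e := by
    rw [DenseRange, ← LinearMap.coe_range, Finsupp.range_linearCombination]
    exact dense_span_tensorConj
  have hHc : Continuous fun p : 𝓢(Phase V, ℂ) × 𝓢(Phase V, ℂ) => H p.1 p.2 := by
    have h1 : Continuous fun p : 𝓢(Phase V, ℂ) × 𝓢(Phase V, ℂ) => D p.1 :=
      D.continuous.comp continuous_fst
    have h2 : Continuous fun p : 𝓢(Phase V, ℂ) × 𝓢(Phase V, ℂ) => starRingEnd ℂ (D p.2) :=
      Complex.continuous_conj.comp (D.continuous.comp continuous_snd)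
    exact (h1.mul h2).add
      ((J.continuous.comp continuous_fst).inner (J.continuous.comp continuous_snd))
  -- By `hNe`, the squared norm of `N x` is `H (e x) (e x)`, and `H` is continuous.
  obtain ⟨U, hU⟩ := exists_extension e N hdense (q := fun Φ => √‖H Φ Φ‖)
    (Real.continuous_sqrt.comp (hHc.comp (continuous_id.prodMk continuous_id)).norm)
    (by simp [H]) fun x => by
      rw [← hNe]
      refine Real.le_sqrt_of_sq_le ?_
      rw [inner_self_eq_norm_sq_to_K]
      simp
  have hUX : ∀ a b, U (tensorConj a b) = X (a, b) := fun a b => by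
    have := hU (Finsupp.single (a, b) 1)
    rwa [he1, hN1, one_smul, map_one, one_smul] at this
  have hsq : IsTensorSquare u U := fun a b => by
    rw [hUX]
    exact (hm (a, b)).coeFn_toLp
  have hmean : meanD U = D := ext_of_tensorConj fun a b => by
    rw [meanD_apply, hD, ← hν, covOp_apply]
    exact integral_congr_ae (hsq a b)
  refine ⟨U, hsq, hmean, fun Φ Ψ => ?_⟩
  have hcov : ∀ Φ Ψ, inner ℂ (U Ψ) (U Φ) = H Φ Ψ := fun Φ Ψ => by
    refine hdense.induction_on₂ (p := fun Φ Ψ => inner ℂ (U Ψ) (U Φ) = H Φ Ψ) ?_ ?_ Φ Ψ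
    · exact isClosed_eq ((U.continuous.comp continuous_snd).inner (U.continuous.comp continuous_fst))
        hHc
    · intro x y
      rw [hU, hU, hNe]
  rw [covOp_centered, hmean]
  change inner ℂ (U Ψ) (U Φ) - _ = _
  rw [hcov, pairS_eq_inner]
  simp only [H]
  ring

end TensorSquare

/-! ### Inversion of the partial Fourier transform; uniqueness of Weyl symbols -/

section PartialFourierInversion

lemma pfCLM_inversion {X Y : Type} [NormedAddCommGroup X] [NormedSpace ℝ X]
    [NormedAddCommGroup Y] [InnerProductSpace ℝ Y] [FiniteDimensional ℝ Y]
    [MeasurableSpace Y] [BorelSpace Y] (Φ : 𝓢(X × Y, ℂ)) (x : X) (y : Y) :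
    fourierConst Y ^ 2 * ∫ η, chi η (-y) * pfCLM Φ (x, η) = Φ (x, y) :=
  integral_chi_integral_chi (f := fun y => Φ (x, y)) (Φ.continuous.comp (by fun_prop))
    (pf_slice_integrable Φ x) (pf_slice_integrable (pfCLM Φ) x) y

variable {V : Type} [NormedAddCommGroup V] [InnerProductSpace ℝ V] [FiniteDimensional ℝ V]
  [MeasurableSpace V] [BorelSpace V]

lemma partialFourier_eq (Φ : 𝓢(Phase V, ℂ)) (x η : V) :
    partialFourier Φ (pt x η) = fourierConst V * ∫ y, chi y η * Φ (pt x y) := rfl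

lemma chi_neg_right (y η : V) : chi y (-η) = starRingEnd ℂ (chi y η) := by
  simp [chi, ← Complex.exp_conj, inner_neg_right]

lemma chi_add_left (y z η : V) : chi (y + z) η = chi y η * chi z η := by
  rw [chi, chi, chi, ← Complex.exp_add, inner_add_left]
  congr 1
  push_cast
  ring

lemma chi_neg_left (y η : V) : chi (-y) η = starRingEnd ℂ (chi y η) := by
  rw [← chi_neg_right]
  simp [chi, inner_neg_right]

lemma partialFourierInv_eq (Φ : 𝓢(Phase V, ℂ)) (x y : V) :
    partialFourierInv Φ (pt x y) = fourierConst V * ∫ η, chi η (-y) * Φ (pt x η) := rfl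

lemma partialFourierInv_partialFourier (Φ : 𝓢(Phase V, ℂ)) :
    partialFourierInv (partialFourier Φ) = Φ := by
  ext p
  obtain ⟨x, y, rfl⟩ : ∃ x y, p = pt x y := ⟨p.fst, p.snd, rfl⟩
  have h := pfCLM_inversion (compS (WithLp.prodContinuousLinearEquiv 2 ℝ V V).symm Φ) x y
  change _ = Φ (pt x y) at h
  have h2 : ∀ η, chi η (-y) * partialFourier Φ (pt x η) = fourierConst V * (chi η (-y) *
      pfCLM (compS (WithLp.prodContinuousLinearEquiv 2 ℝ V V).symm Φ) (x, η)) := fun η =>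
    mul_left_comm _ _ _
  simp_rw [partialFourierInv_eq, h2]
  rw [integral_const_mul, ← h]
  ring

/-- The partial transform commutes with the reflection of the second variable, so the left inverse
is also a right inverse. -/
lemma partialFourier_partialFourierInv (Φ : 𝓢(Phase V, ℂ)) :
    partialFourier (partialFourierInv Φ) = Φ := by
  have h : partialFourier (partialFourierInv Φ) = partialFourierInv (partialFourier Φ) := by
    ext p
    obtain ⟨x, y, rfl⟩ : ∃ x y, p = pt x y := ⟨p.fst, p.snd, rfl⟩
    rw [partialFourier_eq, partialFourierInv_eq, ← integral_neg_eq_self]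
    congr 2
    funext η
    change chi (-η) y * partialFourier Φ (pt x (- -η)) = _
    rw [neg_neg, chi_neg_left, chi_neg_right]
  rw [h, partialFourierInv_partialFourier]

/-- The pullback `Φ ↦ (𝓕₂⁻¹ Φ) ∘ κ⁻¹`. -/
def invWigner (V : Type) [NormedAddCommGroup V] [InnerProductSpace ℝ V] [FiniteDimensional ℝ V]
    [MeasurableSpace V] [BorelSpace V] : 𝓢(Phase V, ℂ) →L[ℂ] 𝓢(Phase V, ℂ) :=
  (compS (kappa V).symm).comp partialFourierInv

lemma invWigner_apply (Φ : 𝓢(Phase V, ℂ)) (s t : V) :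
    invWigner V Φ (pt s t) = fourierConst V *
      ∫ η, chi η (-(s - t)) * Φ (pt ((1 / 2 : ℝ) • s + (1 / 2 : ℝ) • t) η) := rfl

/-- Cross-Wigner distributions are the images of tensors under `𝓕₂` after composition with `κ`.
Tensors are total and this map is onto, so the symbol is determined by its values on them. -/
lemma isWeylSymbol_unique {K : 𝓢(V, ℂ) →ₗ[ℂ] TempDist V} {σ σ' : TempDist (Phase V)}
    (h : IsWeylSymbol σ K) (h' : IsWeylSymbol σ' K) : σ' = σ := by
  let L : 𝓢(Phase V, ℂ) →L[ℂ] 𝓢(Phase V, ℂ) := partialFourier.comp (compS (kappa V))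
  have h1 : σ'.comp L = σ.comp L := ext_of_tensorConj fun f g => by
    have h2 := (h g f).symm.trans (h' g f)
    exact (mul_left_cancel₀ fourierConst_ne_zero h2).symm
  ext Φ
  have h3 : L (compS (kappa V).symm (partialFourierInv Φ)) = Φ := by
    have : compS (kappa V) (compS (kappa V).symm (partialFourierInv Φ)) = partialFourierInv Φ := by
      ext x; simp
    change partialFourier (compS (kappa V) (compS (kappa V).symm (partialFourierInv Φ))) = Φ
    rw [this, partialFourier_partialFourierInv]
  rw [← h3]
  exact congrArg (fun T : TempDist (Phase V) => T (compS (kappa V).symm (partialFourierInv Φ))) h1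

end PartialFourierInversion

/-! ### Determinants of the coordinate changes -/

section Determinants

variable {V : Type} [NormedAddCommGroup V] [InnerProductSpace ℝ V] [FiniteDimensional ℝ V]

/-- The determinant squares to `1`. The coordinate changes below are factored into involutions,
which avoids matrices and works for any `V`. -/
lemma abs_det_of_involutive {E : Type} [AddCommGroup E] [Module ℝ E] {f : E →ₗ[ℝ] E}
    (h : ∀ x, f (f x) = x) : |LinearMap.det f| = 1 := by
  have h1 : f * f = 1 := LinearMap.ext h
  have h2 := congrArg LinearMap.det h1
  rw [map_mul, map_one] at h2
  rcases mul_self_eq_one_iff.1 h2 with h | h <;> simp [h]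

/-- The linear map `(x, y) ↦ (a x + b y, c x + e y)`. -/
def pairMap (V : Type) [NormedAddCommGroup V] [InnerProductSpace ℝ V] (a b c e : ℝ) :
    Phase V →ₗ[ℝ] Phase V where
  toFun p := pt (a • p.fst + b • p.snd) (c • p.fst + e • p.snd)
  map_add' p q := by apply phase_ext <;> simp <;> module
  map_smul' r p := by apply phase_ext <;> simp <;> module

/-- The four equations say that the matrix with rows `(a, b)` and `(c, e)` squares to the identity.
-/
lemma abs_det_pairMap {a b c e : ℝ} (h₁ : a * a + b * c = 1) (h₂ : c * b + e * e = 1)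
    (h₃ : b * (a + e) = 0) (h₄ : c * (a + e) = 0) : |LinearMap.det (pairMap V a b c e)| = 1 := by
  refine abs_det_of_involutive fun p => ?_
  apply phase_ext
  · change a • (a • p.fst + b • p.snd) + b • (c • p.fst + e • p.snd) = p.fst
    calc _ = (a * a + b * c) • p.fst + (b * (a + e)) • p.snd := by module
      _ = p.fst := by rw [h₁, h₃]; module
  · change c • (a • p.fst + b • p.snd) + e • (c • p.fst + e • p.snd) = p.snd
    calc _ = (c * (a + e)) • p.fst + (c * b + e * e) • p.snd := by module
      _ = p.snd := by rw [h₂, h₄]; module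

lemma abs_det_kappa : |LinearMap.det (kappa V : Phase V →ₗ[ℝ] Phase V)| = 1 := by
  have h : (kappa V : Phase V →ₗ[ℝ] Phase V)
      = pairMap V 1 0 1 (-1) * (pairMap V (-1) (1 / 2) 0 1 * pairMap V (-1) 0 0 1) := by
    refine LinearMap.ext fun p => ?_
    apply phase_ext
    · change p.fst + (1 / 2 : ℝ) • p.snd = (1 : ℝ) • ((-1 : ℝ) • ((-1 : ℝ) • p.fst + (0 : ℝ) • p.snd)
        + (1 / 2 : ℝ) • ((0 : ℝ) • p.fst + (1 : ℝ) • p.snd))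
        + (0 : ℝ) • ((0 : ℝ) • ((-1 : ℝ) • p.fst + (0 : ℝ) • p.snd)
        + (1 : ℝ) • ((0 : ℝ) • p.fst + (1 : ℝ) • p.snd))
      module
    · change p.fst - (1 / 2 : ℝ) • p.snd = (1 : ℝ) • ((-1 : ℝ) • ((-1 : ℝ) • p.fst + (0 : ℝ) • p.snd)
        + (1 / 2 : ℝ) • ((0 : ℝ) • p.fst + (1 : ℝ) • p.snd))
        + (-1 : ℝ) • ((0 : ℝ) • ((-1 : ℝ) • p.fst + (0 : ℝ) • p.snd)
        + (1 : ℝ) • ((0 : ℝ) • p.fst + (1 : ℝ) • p.snd))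
      module
  rw [h, map_mul, map_mul, abs_mul, abs_mul, abs_det_pairMap, abs_det_pairMap, abs_det_pairMap] <;>
    norm_num

/-- A linear map acting in the first factor. -/
def onFst (f : Phase V →ₗ[ℝ] Phase V) : Phase (Phase V) →ₗ[ℝ] Phase (Phase V) where
  toFun z := pt (f z.fst) z.snd
  map_add' p q := by apply phase_ext <;> simp
  map_smul' r p := by apply phase_ext <;> simp

/-- The transposition `(x₁, x₂, ξ₁, ξ₂) ↦ (x₁, ξ₂, ξ₁, x₂)`. -/
def swapInner (V : Type) [NormedAddCommGroup V] [InnerProductSpace ℝ V] :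
    Phase (Phase V) →ₗ[ℝ] Phase (Phase V) where
  toFun z := pt (pt z.fst.fst z.snd.snd) (pt z.snd.fst z.fst.snd)
  map_add' p q := by apply phase_ext <;> apply phase_ext <;> simp
  map_smul' r p := by apply phase_ext <;> apply phase_ext <;> simp

/-- The transposition `(x₁, x₂, ξ₁, ξ₂) ↦ (x₁, x₂, ξ₂, ξ₁)`. -/
def swapSnd (V : Type) [NormedAddCommGroup V] [InnerProductSpace ℝ V] :
    Phase (Phase V) →ₗ[ℝ] Phase (Phase V) where
  toFun z := pt z.fst (pt z.snd.snd z.snd.fst)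
  map_add' p q := by
    apply phase_ext
    · simp
    · apply phase_ext <;> simp
  map_smul' r p := by
    apply phase_ext
    · simp
    · apply phase_ext <;> simp

lemma abs_det_onFst_pairMap {a b c e : ℝ} (h₁ : a * a + b * c = 1) (h₂ : c * b + e * e = 1)
    (h₃ : b * (a + e) = 0) (h₄ : c * (a + e) = 0) :
    |LinearMap.det (onFst (pairMap V a b c e))| = 1 := by
  refine abs_det_of_involutive fun z => ?_
  apply phase_ext
  · apply phase_ext
    · change a • (a • z.fst.fst + b • z.fst.snd) + b • (c • z.fst.fst + e • z.fst.snd) = z.fst.fst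
      calc _ = (a * a + b * c) • z.fst.fst + (b * (a + e)) • z.fst.snd := by module
        _ = z.fst.fst := by rw [h₁, h₃]; module
    · change c • (a • z.fst.fst + b • z.fst.snd) + e • (c • z.fst.fst + e • z.fst.snd) = z.fst.snd
      calc _ = (c * (a + e)) • z.fst.fst + (c * b + e * e) • z.fst.snd := by module
        _ = z.fst.snd := by rw [h₂, h₄]; module
  · rfl

lemma abs_det_symbolCoord :
    |LinearMap.det (symbolCoord V : Phase (Phase V) →ₗ[ℝ] Phase (Phase V))| = 1 := by
  -- Two transpositions bring `(x₁, ξ₂)` to the front; then the involutions from the factorization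
  -- of `κ` act, without the sign change of `x₁`.
  have h : (symbolCoord V : Phase (Phase V) →ₗ[ℝ] Phase (Phase V))
      = onFst (pairMap V 1 0 1 (-1)) * (onFst (pairMap V (-1) (1 / 2) 0 1)
        * (swapSnd V * swapInner V)) := by
    refine LinearMap.ext fun z => ?_
    apply phase_ext
    · apply phase_ext
      · change -z.fst.fst + (1 / 2 : ℝ) • z.snd.snd
          = (1 : ℝ) • ((-1 : ℝ) • z.fst.fst + (1 / 2 : ℝ) • z.snd.snd) + (0 : ℝ) • _
        module
      · change -z.fst.fst - (1 / 2 : ℝ) • z.snd.snd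
          = (1 : ℝ) • ((-1 : ℝ) • z.fst.fst + (1 / 2 : ℝ) • z.snd.snd)
            + (-1 : ℝ) • ((0 : ℝ) • z.fst.fst + (1 : ℝ) • z.snd.snd)
        module
    · rfl
  rw [h, map_mul, map_mul, map_mul, abs_mul, abs_mul, abs_mul, abs_det_onFst_pairMap,
    abs_det_onFst_pairMap, abs_det_of_involutive (f := swapSnd V) fun _ => rfl,
    abs_det_of_involutive (f := swapInner V) fun _ => rfl] <;> norm_num

lemma measurePreserving_kappa [MeasurableSpace V] [BorelSpace V] :
    MeasurePreserving (kappa V) := by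
  refine ⟨(kappa V).continuous.measurable, ?_⟩
  have hd : LinearMap.det (kappa V : Phase V →ₗ[ℝ] Phase V) ≠ 0 := fun h => by
    have := abs_det_kappa (V := V)
    rw [h] at this
    simp at this
  have h := Measure.map_linearMap_addHaar_eq_smul_addHaar (volume : Measure (Phase V)) hd
  rw [abs_inv, abs_det_kappa] at h
  simpa using h

end Determinants

/-! ### Partial integrals of cross-Wigner distributions -/

section PhaseIntegrals

variable {V : Type} [NormedAddCommGroup V] [InnerProductSpace ℝ V] [FiniteDimensional ℝ V]
  [MeasurableSpace V] [BorelSpace V]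

lemma fourierConst_phase : fourierConst (Phase V) = fourierConst V ^ 2 := by
  have h : Module.finrank ℝ (Phase V) = Module.finrank ℝ V + Module.finrank ℝ V := by
    rw [← Module.finrank_prod]
    exact (WithLp.linearEquiv 2 ℝ (V × V)).finrank_eq
  rw [fourierConst, h, sq, fourierConst, ← Complex.ofReal_mul, ← Real.rpow_add (by positivity)]
  congr 2
  push_cast
  ring

lemma tensorM_volume : tensorM (volume : Measure V) volume = volume := by
  rw [tensorM, ← Measure.volume_eq_prod]
  exact (WithLp.volume_preserving_toLp V V).map_eq

lemma integral_phase (F : Phase V → ℂ) : ∫ q, F q = ∫ p : V × V, F (pt p.1 p.2) := by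
  rw [← tensorM_volume, integral_tensorM, Measure.volume_eq_prod]

lemma integrable_tensorM_iff {ν ρ : Measure V} {F : Phase V → ℂ} :
    Integrable F (tensorM ν ρ) ↔ Integrable (fun p : V × V => F (pt p.1 p.2)) (ν.prod ρ) :=
  (MeasurableEquiv.toLp 2 (V × V)).measurableEmbedding.integrable_map_iff

lemma integrable_phase_iff {F : Phase V → ℂ} :
    Integrable F ↔ Integrable (fun p : V × V => F (pt p.1 p.2)) := by
  rw [← tensorM_volume, integrable_tensorM_iff, Measure.volume_eq_prod]

lemma integral_phase_prod {F : Phase V → ℂ} (hF : Integrable F) :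
    ∫ q, F q = ∫ x, ∫ y, F (pt x y) := by
  rw [integrable_phase_iff, Measure.volume_eq_prod] at hF
  rw [integral_phase, Measure.volume_eq_prod, integral_prod _ hF]

lemma tensorM_reflectM (ν ρ : Measure V) [ν.HasTemperateGrowth] [ρ.HasTemperateGrowth] :
    tensorM (reflectM ν) (reflectM ρ) = reflectM (tensorM ν ρ) := by
  have := sigmaFinite_of_hasTemperateGrowth ν
  have := sigmaFinite_of_hasTemperateGrowth ρ
  have hl : Measurable (WithLp.toLp 2 : V × V → Phase V) :=
    (MeasurableEquiv.toLp 2 (V × V)).measurable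
  rw [tensorM, tensorM, reflectM, reflectM, reflectM,
    Measure.map_prod_map _ _ measurable_neg measurable_neg,
    Measure.map_map hl (measurable_neg.prodMap measurable_neg), Measure.map_map measurable_neg hl]
  rfl

/-- The isomorphism `((x, y₁), y₂) ↦ (x, (y₁, y₂))`. -/
def slotIso (V : Type) [NormedAddCommGroup V] [InnerProductSpace ℝ V] [FiniteDimensional ℝ V] :
    ((Phase V × V) × V) ≃L[ℝ] Phase (Phase V) :=
  LinearEquiv.toContinuousLinearEquiv
    { toFun := fun z => pt z.1.1 (pt z.1.2 z.2)
      invFun := fun w => ((w.fst, w.snd.fst), w.snd.snd)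
      map_add' := fun _ _ => rfl
      map_smul' := fun _ _ => rfl
      left_inv := fun _ => rfl
      right_inv := fun _ => rfl }

/-- The isomorphism `((x, y), z) ↦ ((x, z), y)`. -/
def exchangeIso (X V : Type) [NormedAddCommGroup X] [NormedSpace ℝ X] [FiniteDimensional ℝ X]
    [NormedAddCommGroup V] [NormedSpace ℝ V] [FiniteDimensional ℝ V] :
    ((X × V) × V) ≃L[ℝ] ((X × V) × V) :=
  LinearEquiv.toContinuousLinearEquiv
    { toFun := fun z => ((z.1.1, z.2), z.1.2)
      invFun := fun z => ((z.1.1, z.2), z.1.2)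
      map_add' := fun _ _ => rfl
      map_smul' := fun _ _ => rfl
      left_inv := fun _ => rfl
      right_inv := fun _ => rfl }

/-- The isomorphism `((x₁, ξ₂), (x₂, ξ₁)) ↦ (x₁, x₂, ξ₁, ξ₂)`. -/
def middleIso (V : Type) [NormedAddCommGroup V] [InnerProductSpace ℝ V] [FiniteDimensional ℝ V] :
    ((V × V) × Phase V) ≃L[ℝ] Phase (Phase V) :=
  LinearEquiv.toContinuousLinearEquiv
    { toFun := fun z => pt (pt z.1.1 z.2.fst) (pt z.2.snd z.1.2)
      invFun := fun w => ((w.fst.fst, w.snd.snd), pt w.fst.snd w.snd.fst)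
      map_add' := fun _ _ => rfl
      map_smul' := fun _ _ => rfl
      left_inv := fun _ => rfl
      right_inv := fun _ => rfl }

lemma chi_pt (y₁ y₂ ξ₁ ξ₂ : V) : chi (pt y₁ y₂) (pt ξ₁ ξ₂) = chi y₁ ξ₁ * chi y₂ ξ₂ := by
  rw [chi, chi, chi, ← Complex.exp_add, WithLp.prod_inner_apply]
  congr 1
  push_cast
  ring

lemma chi_zero_right (y : V) : chi y 0 = 1 := by simp [chi]

/-- Integrating out the first frequency of a partial Fourier transform in two variables restricts
the function to the zero set of the conjugate variable. -/
lemma integral_partialFourier_pt (Φ : 𝓢(Phase (Phase V), ℂ)) (x : Phase V) (ξ₂ : V) :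
    ∫ ξ₁, partialFourier Φ (pt x (pt ξ₁ ξ₂)) = ∫ y₂, chi y₂ ξ₂ * Φ (pt x (pt 0 y₂)) := by
  -- The transform in `(y₁, y₂)` is split: `H` is already transformed in `y₂`, and its last variable
  -- is `y₁`. Integrating its transform over `ξ₁` is Fourier inversion at `y₁ = 0`, with exactly the
  -- constant `fourierConst (Phase V)`.
  let H := compS (exchangeIso (Phase V) V) (pfCLM (compS (slotIso V) Φ))
  have h1 : ∀ ξ₁, partialFourier Φ (pt x (pt ξ₁ ξ₂))
      = fourierConst (Phase V) * pfCLM H ((x, ξ₂), ξ₁) := fun ξ₁ => by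
    rw [partialFourier_eq]
    have hi : Integrable fun y : Phase V => chi y (pt ξ₁ ξ₂) * Φ (pt x y) :=
      pf_integrable (compS (WithLp.prodContinuousLinearEquiv 2 ℝ (Phase V) (Phase V)).symm Φ)
        (x, pt ξ₁ ξ₂)
    rw [integral_phase_prod hi]
    congr 1
    change _ = ∫ y₁, chi y₁ ξ₁ * ∫ y₂, chi y₂ ξ₂ * Φ (pt x (pt y₁ y₂))
    simp_rw [← integral_const_mul, chi_pt, mul_assoc]
  have h2 := pfCLM_inversion H (x, ξ₂) 0
  simp only [neg_zero, chi_zero_right, one_mul] at h2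
  simp_rw [h1]
  rw [integral_const_mul, fourierConst_phase, h2]
  rfl

/-- The Fourier integral of the slice of a function. -/
def sliceFourier (f : 𝓢(Phase V, ℂ)) (x ξ : V) : ℂ := ∫ y, chi y ξ * f (pt x y)

lemma sliceFourier_integrable (f : 𝓢(Phase V, ℂ)) (x ξ : V) :
    Integrable fun y => chi y ξ * f (pt x y) :=
  pf_integrable (compS (WithLp.prodContinuousLinearEquiv 2 ℝ V V).symm f) (x, ξ)

/-- Integration over `ξ₁` sets `y₁ = 0`, so `x₁` is the same in both factors. The remaining integral
over `(x₂, y₂)` becomes a product under the measure preserving `κ`. -/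
lemma integral_crossWigner (g f : 𝓢(Phase V, ℂ)) (x₁ ξ₂ : V) :
    ∫ q : Phase V, crossWigner g f (pt (pt x₁ q.fst) (pt q.snd ξ₂))
      = sliceFourier g x₁ ξ₂ * starRingEnd ℂ (sliceFourier f x₁ ξ₂) := by
  have hi : Integrable fun q : Phase V => crossWigner g f (pt (pt x₁ q.fst) (pt q.snd ξ₂)) :=
    pf_slice_integrable (compS (middleIso V) (crossWigner g f)) (x₁, ξ₂)
  rw [integral_phase_prod hi]
  let K : Phase V → ℂ := fun p => (chi p.fst ξ₂ * g (pt x₁ p.fst))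
    * starRingEnd ℂ (chi p.snd ξ₂ * f (pt x₁ p.snd))
  have hK : Integrable K := by
    rw [integrable_phase_iff]
    exact (sliceFourier_integrable g x₁ ξ₂).mul_prod 
      ((Complex.conjCLE : ℂ →L[ℝ] ℂ).integrable_comp (sliceFourier_integrable f x₁ ξ₂))
  have he : MeasurableEmbedding (kappa V) := (kappa V).toHomeomorph.measurableEmbedding
  have hKi : Integrable fun p => K (kappa V p) :=
    (measurePreserving_kappa.integrable_comp_emb he).2 hK
  have h1 : ∀ x₂, ∫ ξ₁, crossWigner g f (pt (pt x₁ x₂) (pt ξ₁ ξ₂))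
      = ∫ y₂, K (kappa V (pt x₂ y₂)) := fun x₂ => by
    rw [crossWigner, integral_partialFourier_pt]
    refine integral_congr_ae (.of_forall fun y₂ => ?_)
    have e : compS (kappa (Phase V)) (tensorConj g f) (pt (pt x₁ x₂) (pt 0 y₂))
        = g (pt x₁ (x₂ + (1 / 2 : ℝ) • y₂)) * starRingEnd ℂ (f (pt x₁ (x₂ - (1 / 2 : ℝ) • y₂))) := by
      change g (pt (x₁ + (1 / 2 : ℝ) • 0) (x₂ + (1 / 2 : ℝ) • y₂))
        * starRingEnd ℂ (f (pt (x₁ - (1 / 2 : ℝ) • 0) (x₂ - (1 / 2 : ℝ) • y₂))) = _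
      rw [smul_zero, add_zero, sub_zero]
    -- As `y₂` is the difference of the two coordinates of `κ(x₂, y₂)`, the character splits too.
    have e2 : chi y₂ ξ₂ = chi (x₂ + (1 / 2 : ℝ) • y₂) ξ₂
        * starRingEnd ℂ (chi (x₂ - (1 / 2 : ℝ) • y₂) ξ₂) := by
      rw [← chi_neg_left, ← chi_add_left]
      congr 1
      module
    change chi y₂ ξ₂ * compS (kappa (Phase V)) (tensorConj g f) (pt (pt x₁ x₂) (pt 0 y₂))
      = (chi (x₂ + (1 / 2 : ℝ) • y₂) ξ₂ * g (pt x₁ (x₂ + (1 / 2 : ℝ) • y₂)))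
        * starRingEnd ℂ (chi (x₂ - (1 / 2 : ℝ) • y₂) ξ₂ * f (pt x₁ (x₂ - (1 / 2 : ℝ) • y₂)))
    rw [e, e2, map_mul]
    ring
  change ∫ x₂, ∫ ξ₁, crossWigner g f (pt (pt x₁ x₂) (pt ξ₁ ξ₂)) = _
  simp_rw [h1]
  rw [← integral_phase_prod hKi, measurePreserving_kappa.integral_comp he, integral_phase,
    Measure.volume_eq_prod]
  refine (integral_prod_mul (μ := volume) (ν := volume) (fun x => chi x ξ₂ * g (pt x₁ x))
    fun y => starRingEnd ℂ (chi y ξ₂ * f (pt x₁ y))).trans ?_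
  rw [integral_conj]
  rfl

/-- The slice and the frequency are the `x₁` and `ξ₂` that the coordinates of the symbol send to
`(a, b)`; the sign accounts for the reflected measure. -/
lemma invWigner_eq_sliceFourier (f : 𝓢(Phase V, ℂ)) (a b : V) :
    invWigner V f (-pt a b)
      = fourierConst V * sliceFourier f (-((1 / 2 : ℝ) • (a + b))) (a - b) := by
  have e1 : (1 / 2 : ℝ) • -a + (1 / 2 : ℝ) • -b = -((1 / 2 : ℝ) • (a + b)) := by module
  have e2 : -(-a - -b) = a - b := by abel
  change invWigner V f (pt (-a) (-b)) = _
  rw [invWigner_apply, e1, e2]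
  rfl

end PhaseIntegrals

/-! ### Mean, Weyl symbol and invariance of the Wigner distribution -/

section WignerProcess

variable {V : Type} [NormedAddCommGroup V] [InnerProductSpace ℝ V] [FiniteDimensional ℝ V]
  [MeasurableSpace V] [BorelSpace V]

lemma measureD_tensorM_apply (ν ρ : Measure V) [ν.HasTemperateGrowth] [ρ.HasTemperateGrowth]
    (Φ : 𝓢(Phase V, ℂ)) :
    measureD (tensorM ν ρ) Φ = ∫ x, ∫ y, starRingEnd ℂ (Φ (pt x y)) ∂ρ ∂ν := by
  have := sigmaFinite_of_hasTemperateGrowth ν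
  have := sigmaFinite_of_hasTemperateGrowth ρ
  have hi : Integrable (fun p => starRingEnd ℂ (Φ p)) (tensorM ν ρ) :=
    (Complex.conjCLE : ℂ →L[ℝ] ℂ).integrable_comp Φ.integrable
  rw [integrable_tensorM_iff] at hi
  rw [measureD_apply, integral_tensorM, integral_prod _ hi]

lemma conj_fourierConst : starRingEnd ℂ (fourierConst V) = fourierConst V := by
  obtain ⟨c, -, hc⟩ := fourierConst_pos (V := V)
  rw [hc, Complex.conj_ofReal]

/-- `κ⁻¹` sends `(x, x)` to `(x, 0)`, and the inverse Fourier transform at `0` is the plain integral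
over the frequency. -/
lemma measureD_diagS_invWigner (ν : Measure V) [ν.HasTemperateGrowth] (Φ : 𝓢(Phase V, ℂ)) :
    measureD ν (diagS V (invWigner V Φ))
      = fourierConst V * measureD (tensorM ν volume) Φ := by
  rw [measureD_apply, measureD_tensorM_apply, ← integral_const_mul]
  refine integral_congr_ae (.of_forall fun x => ?_)
  have e : (1 / 2 : ℝ) • x + (1 / 2 : ℝ) • x = x := by module
  simp only [diagS_apply, invWigner_apply, e, sub_self, neg_zero, chi_zero_right, one_mul,
    map_mul, conj_fourierConst, integral_conj]

/-- The distribution `(μ ⊗ μ ⊗ 1 ⊗ 1) ∘ B` on `V⁴`. -/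
def symbolD (μ : Measure V) [μ.HasTemperateGrowth] : TempDist (Phase (Phase V)) :=
  compD (measureD (tensorM (tensorM μ μ) (tensorM volume volume))) (symbolCoord V)

lemma symbolD_apply (μ : Measure V) [μ.HasTemperateGrowth] (Θ : 𝓢(Phase (Phase V), ℂ)) :
    symbolD μ Θ = ∫ p : Phase V, (∫ q : Phase V, starRingEnd ℂ (Θ
      (pt (pt (-((1 / 2 : ℝ) • (p.fst + p.snd))) q.fst) (pt q.snd (p.fst - p.snd)))))
      ∂(tensorM μ μ) := by
  have h : symbolD μ Θ = ((|LinearMap.det (symbolCoord V : Phase (Phase V) →ₗ[ℝ] _)|⁻¹ : ℝ) : ℂ) *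
    measureD (tensorM (tensorM μ μ) (tensorM volume volume)) (compS (symbolCoord V).symm Θ) := rfl
  rw [h, abs_det_symbolCoord, measureD_tensorM_apply, tensorM_volume]
  simp only [inv_one, Complex.ofReal_one, one_mul]
  rfl

/-- Both sides are integrals against `μ ⊗ μ`. Unreflecting the measure puts the test functions at
`-(a, b)`, which is the origin of the minus signs in the symbol. The integrands agree by
`integral_crossWigner`, as the Fourier constant on `V × V` is the square of that on `V`. -/
lemma isWeylSymbol_symbolD (μ : Measure V) [μ.HasTemperateGrowth]
    {K : 𝓢(Phase V, ℂ) →ₗ[ℂ] TempDist (Phase V)}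
    (hK : ∀ Φ Ψ, K Ψ Φ = pairS (tensorM (reflectM μ) (reflectM μ)) (invWigner V Φ)
      (invWigner V Ψ)) : IsWeylSymbol (symbolD μ) K := by
  intro f g
  rw [hK, symbolD_apply, pairS, tensorM_reflectM, integral_reflectM, ← integral_const_mul]
  refine integral_congr_ae (.of_forall fun p => ?_)
  obtain ⟨a, b, rfl⟩ : ∃ a b, p = pt a b := ⟨p.fst, p.snd, rfl⟩
  have h := integral_crossWigner g f (-((1 / 2 : ℝ) • (a + b))) (a - b)
  simp only [invWigner_eq_sliceFourier, integral_conj]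
  change _ = fourierConst (Phase V) * starRingEnd ℂ (∫ q : Phase V,
    crossWigner g f (pt (pt (-((1 / 2 : ℝ) • (a + b))) q.fst) (pt q.snd (a - b))))
  simp only [h, map_mul, conj_fourierConst, Complex.conj_conj, fourierConst_phase]
  ring

/-- The shift moves only `x₂` and `ξ₁`, the variables in which the symbol is Lebesgue measure. -/
lemma translD_symbolD (μ : Measure V) [μ.HasTemperateGrowth] (x ξ : V) :
    translD (pt (pt 0 x) (pt ξ 0)) (symbolD μ) = symbolD μ := by
  ext Θ
  change symbolD μ (translS (-pt (pt 0 x) (pt ξ 0)) Θ) = _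
  rw [symbolD_apply, symbolD_apply]
  refine integral_congr_ae (.of_forall fun p => ?_)
  have h := integral_add_right_eq_self (μ := (volume : Measure (Phase V)))
    (fun q : Phase V => starRingEnd ℂ (Θ
      (pt (pt (-((1 / 2 : ℝ) • (p.fst + p.snd))) q.fst) (pt q.snd (p.fst - p.snd))))) (pt x ξ)
  refine Eq.trans (integral_congr_ae (.of_forall fun q => ?_)) h
  change starRingEnd ℂ (Θ (_ - -pt (pt 0 x) (pt ξ 0))) = _
  congr 2
  apply phase_ext <;> apply phase_ext <;> simp

/-- `(0, x)`-translations and `(ξ, 0)`-modulations act through `invWigner` by multiplication with a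
unimodular function. -/
lemma invWigner_translS_modS (x ξ : V) (Ψ : 𝓢(Phase V, ℂ)) (s t : V) :
    invWigner V (translS (pt 0 x) (modS (pt ξ 0) Ψ)) (pt s t)
      = chi (-((1 / 2 : ℝ) • s + (1 / 2 : ℝ) • t)) ξ * chi x (-(s - t)) * invWigner V Ψ (pt s t) := by
  rw [invWigner_apply, invWigner_apply]
  set y := (1 / 2 : ℝ) • s + (1 / 2 : ℝ) • t
  -- Shifting `η` by `x` undoes the translation and leaves a character; the modulation depends only
  -- on the midpoint of `s` and `t`.
  rw [← integral_add_right_eq_self _ x, mul_left_comm,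
    ← integral_const_mul (chi (-y) ξ * chi x (-(s - t)))]
  congr 1
  refine integral_congr_ae (.of_forall fun η => ?_)
  have e : translS (pt 0 x) (modS (pt ξ 0) Ψ) (pt y (η + x)) = chi (-y) ξ * Ψ (pt y η) := by
    have e1 : pt y (η + x) - pt 0 x = pt y η := by apply phase_ext <;> simp
    change modS (pt ξ 0) Ψ (pt y (η + x) - pt 0 x) = _
    rw [e1, modS_apply, WithLp.prod_inner_apply, chi]
    simp
  change chi (η + x) _ * translS (pt 0 x) (modS (pt ξ 0) Ψ) (pt y (η + x)) = _
  rw [e, chi_add_left]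
  ring

lemma translS_translS_neg (a : V) (Φ : 𝓢(V, ℂ)) : translS a (translS (-a) Φ) = Φ := by
  ext x
  change Φ (x - a - -a) = Φ x
  congr 1
  abel

lemma modS_modS_neg (b : V) (Φ : 𝓢(V, ℂ)) : modS b (modS (-b) Φ) = Φ := by
  ext x
  rw [modS_apply, modS_apply, ← mul_assoc, ← Complex.exp_add]
  simp [inner_neg_right]

/-- The operator on the right is tested against `Φ'`, the preimage of `Φ` under the translation and
modulation. On the left both arguments thus acquire the same unimodular factor, and one of them is
conjugated. -/
lemma comm_translS_modS {K : 𝓢(Phase V, ℂ) →ₗ[ℂ] TempDist (Phase V)} {ν : Measure (Phase V)}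
    (hK : ∀ Φ Ψ, K Ψ Φ = pairS ν (invWigner V Φ) (invWigner V Ψ)) (x ξ : V) (Ψ : 𝓢(Phase V, ℂ)) :
    K (translS (pt 0 x) (modS (pt ξ 0) Ψ)) = translD (pt 0 x) (modD (pt ξ 0) (K Ψ)) := by
  ext Φ
  set Φ' := modS (-pt ξ 0) (translS (-pt 0 x) Φ)
  have h : translS (pt 0 x) (modS (pt ξ 0) Φ') = Φ := by
    rw [modS_modS_neg, translS_translS_neg]
  change _ = K Ψ Φ'
  rw [hK, hK, ← h, pairS, pairS]
  refine integral_congr_ae (.of_forall fun p => ?_)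
  obtain ⟨s, t, rfl⟩ : ∃ s t, p = pt s t := ⟨p.fst, p.snd, rfl⟩
  have hc : ∀ y η : V, starRingEnd ℂ (chi y η) * chi y η = 1 := fun y η => by
    rw [← Complex.normSq_eq_conj_mul_self, Complex.normSq_eq_norm_sq, norm_chi]
    simp
  simp only [invWigner_translS_modS, map_mul]
  linear_combination
    (starRingEnd ℂ (invWigner V Φ' (pt s t)) * invWigner V Ψ (pt s t)
      * (starRingEnd ℂ (chi x (-(s - t))) * chi x (-(s - t))))
      * hc (-((1 / 2 : ℝ) • s + (1 / 2 : ℝ) • t)) ξ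
    + (starRingEnd ℂ (invWigner V Φ' (pt s t)) * invWigner V Ψ (pt s t)) * hc x (-(s - t))

end WignerProcess

end WignerGSP

end

theorem proposition6p6 {Ω : Type*} [MeasurableSpace Ω] (P : Measure Ω) [IsProbabilityMeasure P]
    (d : ℕ) (u : GSP P (EuclideanSpace ℝ (Fin d)))
    (hmean : IsZeroMean u) (hsymm : IsSymmetricGSP u) (hgauss : IsGaussianGSP u)
    (hstat : IsFrequencyStationary u)
    (μ : Measure (EuclideanSpace ℝ (Fin d))) [μ.HasTemperateGrowth]
    (hμ : IsSpectralMeasure (fourierGSP u) μ) :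
    ∃ U : GSP P (Phase (EuclideanSpace ℝ (Fin d))),
      (IsTensorSquare u U ∧ ∀ U', IsTensorSquare u U' → U' = U) ∧
      meanD (wigner U)
        = fourierConst (EuclideanSpace ℝ (Fin d)) • measureD (tensorM (reflectM μ) volume) ∧
      ∃ σ : TempDist (Phase (Phase (EuclideanSpace ℝ (Fin d)))),
        (IsWeylSymbol σ (covOp (wigner (centered U))) ∧
          ∀ σ', IsWeylSymbol σ' (covOp (wigner (centered U))) → σ' = σ) ∧
        σ = compD (measureD (tensorM (tensorM μ μ) (tensorM volume volume)))
          (symbolCoord (EuclideanSpace ℝ (Fin d))) ∧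
        (∀ x ξ : EuclideanSpace ℝ (Fin d), translD (pt (pt 0 x) (pt ξ 0)) σ = σ) ∧
        ∀ (x ξ : EuclideanSpace ℝ (Fin d)) (Ψ : 𝓢(Phase (EuclideanSpace ℝ (Fin d)), ℂ)),
          covOp (wigner (centered U)) (translS (pt 0 x) (modS (pt ξ 0) Ψ))
            = translD (pt 0 x) (modD (pt ξ 0) (covOp (wigner (centered U)) Ψ)) := by
  -- The reflection of `μ` is the measure whose `L²` pairing is the covariance of `u`.
  obtain ⟨U, hU, hmeanU, hcov⟩ := exists_isTensorSquare hsymm hgauss (reflectM μ)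
    (covOp_eq_integral hμ)
  have hK : ∀ Φ Ψ, covOp (wigner (centered U)) Ψ Φ
      = pairS (tensorM (reflectM μ) (reflectM μ)) (invWigner _ Φ) (invWigner _ Ψ) :=
    fun Φ Ψ => hcov _ _
  have hσ := isWeylSymbol_symbolD μ hK
  refine ⟨U, ⟨hU, fun U' => isTensorSquare_unique hU⟩, ?_, symbolD μ,
    ⟨hσ, fun σ' => isWeylSymbol_unique hσ⟩, rfl, translD_symbolD μ, comm_translS_modS hK⟩
  ext Φ
  change meanD U (invWigner _ Φ) = _
  rw [hmeanU]
  exact measureD_diagS_invWigner (reflectM μ) Φ
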